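/- Let $T>0$ and let $f,g,\sigma:\mathbb R_+\times[0,1]\times\mathbb R\to\mathbb R$ be Borel functions such that, for some constants $K,L,M$ and all $t\in[0,T]$, $x\in[0,1]$, $r,p,q\in\mathbb R$: (H1) $|f(t,x,r)|\le K(1+|r|)$; (H2) $g(t,x,r)=g_1(t,x,r)+g_2(t,r)$ with Borel functions $g_1,g_2$ satisfying $|g_1(t,x,r)|\le K(1+|r|)$ and $|g_2(t,r)|\le K(1+|r|^2)$; (H3) $|\sigma(t,x,r)|\le M$, $|\sigma(t,x,p)-\sigma(t,x,q)|\le L|p-q|$, $|f(t,x,p)-f(t,x,q)|\le L(1+|p|+|q|)|p-q|$ and $|g(t,x,p)-g(t,x,q)|\le L(1+|p|+|q|)|p-q|$. Let $G_t(x,y)=2\sum_{n\ge1}e^{-n^2\pi^2t}\sin(n\pi x)\sin(n\pi y)$, $t>0$, be the Green kernel of $\partial_t-\partial_x^2$ on $[0,1]$ with Dirichlet boundary conditions. Then for every $\eta\in L^2([0,1])$ and $v\in L^2([0,T]\times[0,1])$ there exists a unique $h\in C([0,T];L^2([0,1]))$ with $h(0)=\eta$ such that, for every $t\in(0,T]$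 and almost every $x\in[0,1]$, $$ \begin{aligned} h(t,x)={}&\int_0^1 G_t(x,y)\eta(y)\,dy-\int_0^t\!\int_0^1\partial_yG_{t-s}(x,y)\,g(s,y,h(s,y))\,dy\,ds\\ &+\int_0^t\!\int_0^1G_{t-s}(x,y)\,f(s,y,h(s,y))\,dy\,ds+\int_0^t\!\int_0^1G_{t-s}(x,y)\,\sigma(s,y,h(s,y))\,v(s,y)\,dy\,ds, \end{aligned} $$ where all the integrals converge absolutely. -/

import Mathlib

open MeasureTheory Set

noncomputable section

/-- The space `L²([0,1])`. -/
abbrev L2I : Type := Lp ℝ 2 (volume.restrict (Icc (0 : ℝ) 1))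

/-- The space `L²([0,T] × [0,1])`. -/
abbrev L2TI (T : ℝ) : Type :=
  Lp ℝ 2 ((volume : Measure (ℝ × ℝ)).restrict (Icc (0 : ℝ) T ×ˢ Icc (0 : ℝ) 1))

/-- The Green kernel `G_t(x,y)`, `t > 0`, of `∂/∂t - ∂²/∂x²` on `[0,1]` with homogeneous Dirichlet
boundary conditions: `G_t(x,y) = ∑_{n ≥ 1} 2 exp(-n²π²t) sin(nπx) sin(nπy)`. -/
def greenKernel (t x y : ℝ) : ℝ :=
  ∑' n : ℕ, 2 * Real.exp (-(((n : ℝ) + 1) ^ 2 * Real.pi ^ 2 * t)) *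
    Real.sin (((n : ℝ) + 1) * Real.pi * x) * Real.sin (((n : ℝ) + 1) * Real.pi * y)

/-- The derivative `∂_y G_t(x,y)`. -/
def greenKernelDy (t x y : ℝ) : ℝ := deriv (fun z => greenKernel t x z) y

/-- The iterated integral `∫₀ᵗ ∫₀¹ F(s,y) dy ds`. -/
def iterInt (F : ℝ → ℝ → ℝ) (t : ℝ) : ℝ :=
  ∫ s in Ioo (0 : ℝ) t, ∫ y in Icc (0 : ℝ) 1, F s y

/-- The iterated integral `∫₀ᵗ ∫₀¹ F(s,y) dy ds` converges absolutely. It is phrased through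
sections, so that it depends only on the almost everywhere class of `F(s,·)` for each `s`. -/
def IterIntegrable (F : ℝ → ℝ → ℝ) (t : ℝ) : Prop :=
  (∀ᵐ s ∂(volume.restrict (Ioo (0 : ℝ) t)), IntegrableOn (F s) (Icc (0 : ℝ) 1)) ∧
  IntegrableOn (fun s => ∫ y in Icc (0 : ℝ) 1, F s y) (Ioo (0 : ℝ) t) ∧
  IntegrableOn (fun s => ∫ y in Icc (0 : ℝ) 1, |F s y|) (Ioo (0 : ℝ) t)

/-- `h ∈ C([0,T]; L²([0,1]))` satisfies the skeleton equation
`h(t,x) = ∫ G_t(x,y) η(y) dy - ∫∫ ∂_y G_{t-s}(x,y) g(s,y,h(s,y)) dy ds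
  + ∫∫ G_{t-s}(x,y) f(s,y,h(s,y)) dy ds + ∫∫ G_{t-s}(x,y) σ(s,y,h(s,y)) v(s,y) dy ds`
for every `t ∈ (0,T]` as an identity in `L²([0,1])`, that is, for almost every `x`, with absolutely
convergent integrals; at `t = 0`, where `G_0` is the identity operator, the equation reads
`h(0) = η`. The extension `IccExtend` only makes `h(s)` meaningful for a real number `s`; it is
evaluated at `s ∈ [0,T]` only. -/
def IsSkeletonSolution {T : ℝ} (hT : 0 ≤ T) (f g σ : ℝ → ℝ → ℝ → ℝ) (η : L2I) (v : L2TI T)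
    (h : C(Icc (0 : ℝ) T, L2I)) : Prop :=
  h ⟨0, left_mem_Icc.mpr hT⟩ = η ∧
  ∀ t : Icc (0 : ℝ) T, 0 < (t : ℝ) → ∀ᵐ x ∂(volume.restrict (Icc (0 : ℝ) 1)),
    let u : ℝ → ℝ → ℝ := fun s y => IccExtend hT h s y
    let Fg : ℝ → ℝ → ℝ := fun s y => greenKernelDy (t - s) x y * g s y (u s y)
    let Ff : ℝ → ℝ → ℝ := fun s y => greenKernel (t - s) x y * f s y (u s y)
    let Fσ : ℝ → ℝ → ℝ := fun s y => greenKernel (t - s) x y * (σ s y (u s y) * v (s, y))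
    IterIntegrable Fg t ∧ IterIntegrable Ff t ∧ IterIntegrable Fσ t ∧
    h t x = (∫ y in Icc (0 : ℝ) 1, greenKernel t x y * η y)
      - iterInt Fg t + iterInt Ff t + iterInt Fσ t

end

/-! The equation is read in the Dirichlet sine basis of `L²([0,1])`. With frequencies `k_n = (n+1)π`
and `c_n = ⟪e_n, h⟫`, a curve solves the skeleton equation iff each coordinate satisfies the Duhamel
form of `c_n' = -k_n² c_n + a_n(s, h)`, where `a_n` is the sine coefficient of `-∂_y`-tested `g`,
plus `f`, plus `σ v` (`isSkeletonSolution_iff`). This rests on Fubini, on a time-integrable bound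
for the `L¹` norms of the kernels, and on the fact that an integrable function is determined by its
sine coefficients.

Local theory: the derivative falling on `g` costs a factor `k_n` and the control costs a factor `V ∈
L²(0,T)`, so `a_n` is bounded, and locally Lipschitz in `h`, with constants proportional to `k_n +
V(s)`. The Duhamel integral of such a forcing with growth `e^{ls}` has square at most a multiple of
`e^{2lt}/(k_n² + l)` (`sq_duhamel_le`). This is summable in `n`, and the sum tends to `0` as `l →
∞`. Once the nonlinearity is composed with a radial cutoff at radius `R`, the solution map is
therefore a contraction for an exponentially weighted sup norm.

Global theory: the cutoff is removed by an a priori bound independent of `R`. The quadratically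
growing part of `g` contributes nothing to the energy, because `∫ q(W) W' = 0` whenever `W(0) =
W(1)`; the remainder of `g` grows linearly and is absorbed by the dissipation `∫ W'²`
(`skeletonCoeff_energy`). Mild solutions lack the regularity for this computation, so it is done on
Galerkin truncations, which are trigonometric polynomials (`norm_sq_le_of_galerkin`). The
truncations converge uniformly to the cut-off solution, which inherits the bound; for `R` beyond the
bound the cutoff is inactive. For uniqueness, two solutions are fixed points of one cut-off map with
`R` above both norms. -/

noncomputable section

open Filter Topology

/-! ### Cauchy–Schwarz and the scalar Duhamel integral. -/

section CauchySchwarz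

variable {α : Type*} [MeasurableSpace α] {μ : Measure α}

/-- The Cauchy–Schwarz inequality for integrals of real functions. -/
theorem sq_integral_mul_le {f g : α → ℝ} (hf : MemLp f 2 μ) (hg : MemLp g 2 μ) :
    (∫ x, f x * g x ∂μ) ^ 2 ≤ (∫ x, f x ^ 2 ∂μ) * ∫ x, g x ^ 2 ∂μ := by
  have hfg : Integrable (fun x => f x * g x) μ := hf.integrable_mul hg
  have h : ∀ c : ℝ, 0 ≤ (∫ x, f x ^ 2 ∂μ) * (c * c) + (2 * ∫ x, f x * g x ∂μ) * c
      + ∫ x, g x ^ 2 ∂μ := fun c => by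
    have h0 : 0 ≤ ∫ x, (c * f x + g x) ^ 2 ∂μ := integral_nonneg fun x => sq_nonneg _
    have h1 : ∀ x, (c * f x + g x) ^ 2 = c ^ 2 * f x ^ 2 + (2 * c) * (f x * g x) + g x ^ 2 :=
      fun x => by ring
    simp_rw [h1] at h0
    rw [integral_add (by exact (hf.integrable_sq.const_mul _).add (hfg.const_mul _))
      hg.integrable_sq, integral_add (hf.integrable_sq.const_mul _) (hfg.const_mul _),
      integral_const_mul, integral_const_mul] at h0
    linarith
  have := discrim_le_zero h
  rw [discrim] at this
  linarith

end CauchySchwarz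

section Duhamel

/-- The solution at time `t` of `c' = -m c + α`, `c(0) = 0`. -/
def duhamel (m : ℝ) (α : ℝ → ℝ) (t : ℝ) : ℝ :=
  ∫ s in (0 : ℝ)..t, Real.exp (-(m * (t - s))) * α s

/-- Pulling out `exp(-mt)` leaves an integrand independent of `t`, so regularity in `t` reduces to
that of a primitive. -/
theorem duhamel_eq (m : ℝ) (α : ℝ → ℝ) (t : ℝ) :
    duhamel m α t = Real.exp (-(m * t)) * ∫ s in (0 : ℝ)..t, Real.exp (m * s) * α s := by
  rw [duhamel, ← intervalIntegral.integral_const_mul]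
  refine intervalIntegral.integral_congr fun s _ => ?_
  rw [← mul_assoc, ← Real.exp_add]
  ring_nf

variable {T : ℝ} {α : ℝ → ℝ}

theorem absolutelyContinuousOnInterval_exp_mul (m T : ℝ) :
    AbsolutelyContinuousOnInterval (fun t => Real.exp (m * t)) 0 T :=
  ContDiffOn.absolutelyContinuousOnInterval (by fun_prop)

theorem intervalIntegrable_exp_mul_mul (m : ℝ) (hα : IntervalIntegrable α volume 0 T) :
    IntervalIntegrable (fun s => Real.exp (m * s) * α s) volume 0 T :=
  hα.continuousOn_mul (by fun_prop)

/-- The forcing is merely integrable, so trajectories are in general only absolutely continuous;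
this still suffices for the fundamental theorem of calculus applied to their squares. -/
theorem absolutelyContinuousOnInterval_exp_mul_add_duhamel (m c : ℝ)
    (hα : IntervalIntegrable α volume 0 T) :
    AbsolutelyContinuousOnInterval
      (fun t => Real.exp (-(m * t)) * c + duhamel m α t) 0 T := by
  have h1 := absolutelyContinuousOnInterval_exp_mul (-m) T
  have h2 := (intervalIntegrable_exp_mul_mul m hα).absolutelyContinuousOnInterval_intervalIntegral
    (c := 0) left_mem_uIcc
  have h3 : AbsolutelyContinuousOnInterval (fun _ : ℝ => c) 0 T :=
    ContDiffOn.absolutelyContinuousOnInterval contDiffOn_const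
  convert h1.fun_mul (h3.fun_add h2) using 2 with t
  rw [duhamel_eq, neg_mul]
  ring

theorem continuousOn_exp_mul_add_duhamel (m c : ℝ) (hT : 0 ≤ T)
    (hα : IntervalIntegrable α volume 0 T) :
    ContinuousOn (fun t => Real.exp (-(m * t)) * c + duhamel m α t) (Icc 0 T) := by
  have := (absolutelyContinuousOnInterval_exp_mul_add_duhamel m c hα).continuousOn
  rwa [uIcc_of_le hT] at this

/-- The energy identity for the scalar equation `c' = -m c + α`. -/
theorem sq_exp_mul_add_duhamel (m c₀ : ℝ) {c : ℝ → ℝ} {t : ℝ}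
    (hα : IntervalIntegrable α volume 0 t)
    (hc : ∀ s, c s = Real.exp (-(m * s)) * c₀ + duhamel m α s) :
    c t ^ 2 = c₀ ^ 2 + ∫ s in (0 : ℝ)..t, 2 * (c s * (α s - m * c s)) := by
  obtain rfl : c = fun s => Real.exp (-(m * s)) * c₀ + duhamel m α s := funext hc
  have hac := absolutelyContinuousOnInterval_exp_mul_add_duhamel m c₀ hα
  -- Integration by parts for the product of the trajectory with itself; only its almost everywhere
  -- derivative remains to be identified.
  have h0 := hac.integral_deriv_mul_eq_sub hac
  have h1 : Real.exp (-(m * 0)) * c₀ + duhamel m α 0 = c₀ := by simp [duhamel]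
  rw [h1] at h0
  rw [sq, sq, eq_add_of_sub_eq' h0.symm]
  congr 1
  refine intervalIntegral.integral_congr_ae ?_
  filter_upwards [(intervalIntegrable_exp_mul_mul m hα).ae_hasDerivAt_integral] with s hs hs'
  have hd := hs (uIoc_subset_uIcc hs') 0 left_mem_uIcc
  have he : HasDerivAt (fun s : ℝ => Real.exp (-(m * s))) (Real.exp (-(m * s)) * (-(m * 1))) s :=
    ((hasDerivAt_id s).const_mul m).neg.exp
  have hD : HasDerivAt (fun s => Real.exp (-(m * s)) * c₀ + duhamel m α s)
      (α s - m * (Real.exp (-(m * s)) * c₀ + duhamel m α s)) s := by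
    have h2 := (he.mul_const c₀).add (he.mul hd)
    have h3 : (fun s => Real.exp (-(m * s)) * c₀ + duhamel m α s) =
        (fun s => Real.exp (-(m * s)) * c₀ + Real.exp (-(m * s)) *
          ∫ r in (0 : ℝ)..s, Real.exp (m * r) * α r) := funext fun s => by rw [duhamel_eq]
    rw [h3]
    refine h2.congr_deriv ?_
    have h4 : Real.exp (-(m * s)) * (Real.exp (m * s) * α s) = α s := by
      rw [← mul_assoc, ← Real.exp_add]; simp
    rw [h4, duhamel_eq]
    ring
  rw [hD.deriv]
  ring

theorem integral_exp_neg_mul_sub (m t : ℝ) (hm : 0 < m) :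
    ∫ s in (0 : ℝ)..t, Real.exp (-(m * (t - s))) = (1 - Real.exp (-(m * t))) / m := by
  have h : ∀ s ∈ uIcc 0 t, HasDerivAt (fun s => Real.exp (-(m * (t - s))) / m)
      (Real.exp (-(m * (t - s)))) s := fun s _ => by
    have h1 : HasDerivAt (fun s : ℝ => -(m * (t - s))) (-(m * (-1))) s :=
      (((hasDerivAt_id s).const_sub t).const_mul m).neg
    refine (h1.exp.div_const m).congr_deriv ?_
    field_simp
  rw [intervalIntegral.integral_eq_sub_of_hasDerivAt h
    (Continuous.intervalIntegrable (by fun_prop) _ _)]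
  simp
  ring

/-- The growth `e^{ls}` is moved into the semigroup: `e^{-k²(t-s)} e^{ls} = e^{lt} e^{-m(t-s)}` with
`m = k² + l`. The `k` part gives at most `k/m`, whose square is at most `1/m` since `k² ≤ m`;
Cauchy–Schwarz gives `(2m)⁻¹ ∫ V²` for the square of the `V` part. The gain `1/(k² + l)` serves
twice: summability over modes at `l = 0`, smallness for large `l`. -/
theorem sq_duhamel_le {V : ℝ → ℝ} (hV : MemLp V 2 (volume.restrict (Ioc 0 T)))
    {k l B t : ℝ} (hk : 0 < k) (hl : 0 ≤ l) (ht : t ∈ Icc 0 T)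
    (hα : ∀ᵐ s ∂(volume.restrict (Ioc 0 T)), |α s| ≤ B * Real.exp (l * s) * (k + V s)) :
    duhamel (k ^ 2) α t ^ 2 ≤
      (B * Real.exp (l * t)) ^ 2 * ((2 + ∫ s in Ioc 0 T, V s ^ 2) / (k ^ 2 + l)) := by
  set m := k ^ 2 + l with hm_def
  have hm : 0 < m := by positivity
  have hsub : Ioc 0 t ⊆ Ioc 0 T := Ioc_subset_Ioc_right ht.2
  have hVt : MemLp V 2 (volume.restrict (Ioc 0 t)) :=
    hV.mono_measure (Measure.restrict_mono_set _ hsub)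
  have hexp : Continuous fun s => Real.exp (-(m * (t - s))) := by fun_prop
  have hexpL : MemLp (fun s => Real.exp (-(m * (t - s)))) 2 (volume.restrict (Ioc 0 t)) := by
    refine MemLp.of_bound hexp.aestronglyMeasurable 1 ?_
    filter_upwards [ae_restrict_mem measurableSet_Ioc] with s hs
    rw [Real.norm_eq_abs, abs_of_pos (Real.exp_pos _), Real.exp_le_one_iff]
    nlinarith [mul_nonneg hm.le (sub_nonneg.2 hs.2)]
  have hInt1 : IntegrableOn (fun s => Real.exp (-(m * (t - s)))) (Ioc 0 t) :=
    hexp.integrableOn_Ioc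
  have hInt2 : IntegrableOn (fun s => Real.exp (-(m * (t - s))) * V s) (Ioc 0 t) :=
    hexpL.integrable_mul hVt
  have hI1 : ∫ s in Ioc 0 t, Real.exp (-(m * (t - s))) ≤ 1 / m := by
    rw [← intervalIntegral.integral_of_le ht.1, integral_exp_neg_mul_sub m t hm]
    gcongr
    linarith [Real.exp_pos (-(m * t))]
  have hI1' : 0 ≤ ∫ s in Ioc 0 t, Real.exp (-(m * (t - s))) :=
    integral_nonneg fun s => (Real.exp_pos _).le
  have hI2 : (∫ s in Ioc 0 t, Real.exp (-(m * (t - s))) * V s) ^ 2 ≤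
      1 / (2 * m) * ∫ s in Ioc 0 T, V s ^ 2 := by
    refine (sq_integral_mul_le hexpL hVt).trans ?_
    have h1 : ∀ s, Real.exp (-(m * (t - s))) ^ 2 = Real.exp (-((2 * m) * (t - s))) := fun s => by
      rw [← Real.exp_nat_mul]; congr 1; push_cast; ring
    simp_rw [h1]
    refine mul_le_mul ?_ ?_ (integral_nonneg fun s => sq_nonneg _) (by positivity)
    · rw [← intervalIntegral.integral_of_le ht.1, integral_exp_neg_mul_sub _ t (by positivity)]
      gcongr
      linarith [Real.exp_pos (-(2 * m * t))]
    · exact setIntegral_mono_set hV.integrable_sq (ae_of_all _ fun s => sq_nonneg _)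
        hsub.eventuallyLE
  have hD : |duhamel (k ^ 2) α t| ≤ B * Real.exp (l * t) *
      (k * (∫ s in Ioc 0 t, Real.exp (-(m * (t - s)))) +
        ∫ s in Ioc 0 t, Real.exp (-(m * (t - s))) * V s) := by
    rw [duhamel, intervalIntegral.integral_of_le ht.1, ← integral_const_mul k,
      ← integral_add (hInt1.const_mul _) hInt2, ← integral_const_mul, ← Real.norm_eq_abs]
    refine norm_integral_le_of_norm_le (((hInt1.const_mul _).add hInt2).const_mul _) ?_
    filter_upwards [ae_mono (Measure.restrict_mono_set _ hsub) hα] with s hs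
    rw [norm_mul, Real.norm_eq_abs, Real.norm_eq_abs, abs_of_pos (Real.exp_pos _)]
    refine (mul_le_mul_of_nonneg_left hs (Real.exp_pos _).le).trans (le_of_eq ?_)
    have : Real.exp (-(k ^ 2 * (t - s))) * Real.exp (l * s) =
        Real.exp (l * t) * Real.exp (-(m * (t - s))) := by
      rw [← Real.exp_add, ← Real.exp_add, hm_def]; ring_nf
    calc _ = B * (Real.exp (-(k ^ 2 * (t - s))) * Real.exp (l * s)) * (k + V s) := by ring
      _ = _ := by rw [this]; ring
  set I1 := ∫ s in Ioc 0 t, Real.exp (-(m * (t - s)))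
  set I2 := ∫ s in Ioc 0 t, Real.exp (-(m * (t - s))) * V s
  rw [← sq_abs (duhamel _ _ _)]
  refine (pow_le_pow_left₀ (abs_nonneg _) hD 2).trans ?_
  rw [mul_pow]
  refine mul_le_mul_of_nonneg_left ?_ (sq_nonneg _)
  have h3 : (k * I1) ^ 2 ≤ 1 / m := by
    have : (k * I1) ^ 2 ≤ k ^ 2 * (1 / m) ^ 2 := by
      rw [mul_pow]; gcongr
    refine this.trans ?_
    rw [div_pow, one_pow, mul_one_div, div_le_div_iff₀ (by positivity) hm]
    nlinarith [sq_nonneg k]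
  calc (k * I1 + I2) ^ 2 ≤ 2 * (k * I1) ^ 2 + 2 * I2 ^ 2 := by nlinarith [sq_nonneg (k * I1 - I2)]
    _ ≤ 2 * (1 / m) + 2 * (1 / (2 * m) * ∫ s in Ioc 0 T, V s ^ 2) := by gcongr
    _ = _ := by field_simp

end Duhamel

/-! ### Coordinates in a Hilbert basis. -/

section HilbertCoordinates

variable {H : Type*} [NormedAddCommGroup H] [InnerProductSpace ℝ H] (b : HilbertBasis ℕ ℝ H)

theorem hasSum_sq_inner (y : H) : HasSum (fun n => inner ℝ (b n) y ^ 2) (‖y‖ ^ 2) := by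
  have h := b.hasSum_inner_mul_inner y y
  rw [real_inner_self_eq_norm_sq] at h
  refine h.congr_fun fun n => ?_
  rw [real_inner_comm, sq]

theorem eq_of_inner_basis_eq {x y : H} (h : ∀ n, inner ℝ (b n) x = inner ℝ (b n) y) : x = y :=
  b.repr.injective <| by ext n; rw [b.repr_apply_apply, b.repr_apply_apply, h]

theorem exists_inner_basis_eq {x : ℕ → ℝ} (hx : Summable fun n => x n ^ 2) :
    ∃ y : H, ∀ n, inner ℝ (b n) y = x n := by
  have hm : Memℓp x 2 := by
    refine memℓp_gen ?_
    simpa using hx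
  refine ⟨b.repr.symm ⟨x, hm⟩, fun n => ?_⟩
  rw [← b.repr_apply_apply, LinearIsometryEquiv.apply_symm_apply]

theorem norm_sq_le_of_inner_basis {y : H} {d : ℕ → ℝ} (hd : Summable d)
    (hy : ∀ n, inner ℝ (b n) y ^ 2 ≤ d n) : ‖y‖ ^ 2 ≤ ∑' n, d n :=
  hasSum_le hy (hasSum_sq_inner b y) hd.hasSum

/-- A family of vectors with continuous coordinates that are uniformly dominated by a square
summable sequence is continuous. -/
theorem exists_continuousMap_inner_basis_eq {X : Type*} [TopologicalSpace X] {x : ℕ → X → ℝ}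
    (hx : ∀ n, Continuous (x n)) {d : ℕ → ℝ} (hd : Summable d) (hxd : ∀ n t, x n t ^ 2 ≤ d n) :
    ∃ h : C(X, H), ∀ t n, inner ℝ (b n) (h t) = x n t := by
  have hs : ∀ t, Summable fun n => x n t ^ 2 := fun t =>
    Summable.of_nonneg_of_le (fun n => sq_nonneg _) (fun n => hxd n t) hd
  choose h hh using fun t => exists_inner_basis_eq b (hs t)
  refine ⟨⟨h, continuous_iff_continuousAt.2 fun t₀ => ?_⟩, hh⟩
  rw [ContinuousAt, tendsto_iff_norm_sub_tendsto_zero]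
  have h1 : Tendsto (fun t => ∑' n, (x n t - x n t₀) ^ 2) (𝓝 t₀) (𝓝 (∑' _ : ℕ, (0 : ℝ))) := by
    refine tendsto_tsum_of_dominated_convergence (hd.mul_left 4) (fun n => ?_) ?_
    · have : Tendsto (fun t => (x n t - x n t₀) ^ 2) (𝓝 t₀) (𝓝 ((x n t₀ - x n t₀) ^ 2)) :=
        (((hx n).sub continuous_const).pow 2).tendsto t₀
      simpa using this
    · refine Eventually.of_forall fun t n => ?_
      rw [Real.norm_eq_abs, abs_of_nonneg (sq_nonneg _)]
      nlinarith [hxd n t, hxd n t₀, sq_nonneg (x n t + x n t₀)]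
  have h2 : ∀ t, ‖h t - h t₀‖ ^ 2 = ∑' n, (x n t - x n t₀) ^ 2 := fun t => by
    rw [← (hasSum_sq_inner b _).tsum_eq]
    simp_rw [inner_sub_right, hh]
  have h3 : Tendsto (fun t => Real.sqrt (‖h t - h t₀‖ ^ 2)) (𝓝 t₀) (𝓝 (Real.sqrt 0)) := by
    simp_rw [h2]
    simpa using h1.sqrt
  simpa [Real.sqrt_sq (norm_nonneg _)] using h3

end HilbertCoordinates

/-! ### Weighted contractions, radial cutoff and Gronwall. -/

section WeightedFixedPoint

/-- A map that contracts the weighted sup norm `sup ‖h‖ / ω` has a unique fixed point. -/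
theorem existsUnique_fixedPoint_of_weighted_contraction {X E : Type*} [TopologicalSpace X]
    [CompactSpace X] [NormedAddCommGroup E] [NormedSpace ℝ E] [CompleteSpace E]
    (ω : C(X, ℝ)) (hω : ∀ x, 0 < ω x) (Φ : C(X, E) → C(X, E))
    (hΦ : ∀ h k : C(X, E), ∀ B, 0 ≤ B → (∀ x, ‖h x - k x‖ ≤ B * ω x) →
      ∀ x, ‖Φ h x - Φ k x‖ ≤ 1 / 2 * (B * ω x)) :
    ∃! h, Φ h = h := by
  let ω' : C(X, ℝ) := ⟨fun x => (ω x)⁻¹, ω.continuous.inv₀ fun x => (hω x).ne'⟩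
  have h1 : ∀ u : C(X, E), ω • (ω' • u) = u := fun u => by
    ext x; simp [ω', smul_smul, mul_inv_cancel₀ (hω x).ne']
  have h2 : ∀ u : C(X, E), ω' • (ω • u) = u := fun u => by
    ext x; simp [ω', smul_smul, inv_mul_cancel₀ (hω x).ne']
  -- Conjugating with multiplication by `ω` turns the weighted norm into the ordinary sup norm, to
  -- which Banach's theorem applies.
  let Ψ : C(X, E) → C(X, E) := fun u => ω' • Φ (ω • u)
  have hΨ : ContractingWith (1 / 2) Ψ := by
    refine ⟨by norm_num, LipschitzWith.of_dist_le_mul fun u w => ?_⟩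
    rw [ContinuousMap.dist_le (by positivity)]
    intro x
    have hb := hΦ (ω • u) (ω • w) (dist u w) dist_nonneg (fun x => by
      have : ‖u x - w x‖ ≤ dist u w := by
        rw [← dist_eq_norm]; exact ContinuousMap.dist_apply_le_dist x
      simp only [ContinuousMap.smul_apply', ← smul_sub, norm_smul, Real.norm_eq_abs,
        abs_of_pos (hω x)]
      rw [mul_comm]
      exact mul_le_mul_of_nonneg_right this (hω x).le) x
    simp only [Ψ, ω', ContinuousMap.smul_apply', ContinuousMap.coe_mk, dist_eq_norm, ← smul_sub,
      norm_smul, Real.norm_eq_abs, abs_of_pos (inv_pos.2 (hω x))]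
    rw [inv_mul_le_iff₀ (hω x)]
    refine hb.trans (le_of_eq ?_)
    rw [dist_eq_norm]
    push_cast
    ring
  refine ⟨ω • hΨ.fixedPoint, ?_, fun h hh => ?_⟩
  · have h3 : ω' • Φ (ω • hΨ.fixedPoint) = hΨ.fixedPoint := hΨ.fixedPoint_isFixedPt
    have h4 := congrArg (fun u => ω • u) h3
    simpa only [h1] using h4
  · have h3 : Function.IsFixedPt Ψ (ω' • h) := by
      simp only [Function.IsFixedPt, Ψ, h1]
      rw [hh]
    rw [← hΨ.fixedPoint_unique h3, h1]

end WeightedFixedPoint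

section RadialCutoff

variable {E : Type*} [NormedAddCommGroup E] [NormedSpace ℝ E]

/-- The radial retraction onto the closed ball of radius `R`. -/
def radialCutoff (R : ℝ) (w : E) : E := (R / max R ‖w‖) • w

variable {R : ℝ}

theorem radialCutoff_of_norm_le (hR : 0 < R) {w : E} (hw : ‖w‖ ≤ R) : radialCutoff R w = w := by
  rw [radialCutoff, max_eq_left hw, div_self hR.ne', one_smul]

theorem norm_radialCutoff_le (hR : 0 < R) (w : E) : ‖radialCutoff R w‖ ≤ R := by
  have hm : 0 < max R ‖w‖ := lt_max_of_lt_left hR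
  rw [radialCutoff, norm_smul, Real.norm_eq_abs, abs_of_pos (by positivity), div_mul_eq_mul_div,
    div_le_iff₀ hm]
  exact mul_le_mul_of_nonneg_left (le_max_right _ _) hR.le

theorem continuous_radialCutoff (hR : 0 < R) : Continuous (radialCutoff R : E → E) := by
  unfold radialCutoff
  refine Continuous.smul (Continuous.div continuous_const (by fun_prop) fun w => ?_) continuous_id
  exact (lt_max_of_lt_left hR).ne'

/-- The difference splits into `(R/p)(w - z)` and `(R/p - R/q) z`. Each is at most `‖w - z‖`,
because `t ↦ max R t` is 1-Lipschitz and `‖z‖ ≤ q`; hence the constant 2, with no inner product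
needed. -/
theorem norm_radialCutoff_sub_le (hR : 0 < R) (w z : E) :
    ‖radialCutoff R w - radialCutoff R z‖ ≤ 2 * ‖w - z‖ := by
  set p := max R ‖w‖ with hp
  set q := max R ‖z‖ with hq
  have hp0 : 0 < p := lt_max_of_lt_left hR
  have hq0 : 0 < q := lt_max_of_lt_left hR
  have h1 : radialCutoff R w - radialCutoff R z = (R / p) • (w - z) + (R / p - R / q) • z := by
    rw [radialCutoff, radialCutoff, ← hp, ← hq, smul_sub, sub_smul]; abel
  have hpq : |q - p| ≤ ‖w - z‖ := by
    refine (abs_max_sub_max_le_max _ _ _ _).trans ?_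
    rw [sub_self, abs_zero, max_eq_right (abs_nonneg _), norm_sub_rev]
    exact abs_norm_sub_norm_le _ _
  have h2 : |R / p| ≤ 1 := by
    rw [abs_of_pos (by positivity), div_le_one hp0]; exact le_max_left _ _
  have h3 : |R / p - R / q| * ‖z‖ ≤ ‖w - z‖ := by
    have h4 : R / p - R / q = (R / p) * ((q - p) / q) := by field_simp
    rw [h4, abs_mul, abs_div (q - p) q, abs_of_pos hq0]
    have h5 : ‖z‖ / q ≤ 1 := by rw [div_le_one hq0]; exact le_max_right _ _
    calc |R / p| * (|q - p| / q) * ‖z‖ = |R / p| * |q - p| * (‖z‖ / q) := by ring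
      _ ≤ 1 * ‖w - z‖ * 1 := by gcongr
      _ = _ := by ring
  rw [h1]
  refine (norm_add_le _ _).trans ?_
  rw [norm_smul, norm_smul, Real.norm_eq_abs, Real.norm_eq_abs]
  nlinarith [norm_nonneg (w - z)]

end RadialCutoff

section Gronwall

/-- `X` need not be differentiable, but the right-hand side of the integral inequality is, with
derivative `K X` at most `K` times itself; differential Gronwall is applied to it. -/
theorem le_mul_exp_of_le_add_integral {X : ℝ → ℝ} (hX : Continuous X) (hX0 : ∀ s, 0 ≤ X s)
    {D K T : ℝ} (hK : 0 ≤ K)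
    (h : ∀ t ∈ Icc 0 T, X t ≤ D + K * ∫ s in (0 : ℝ)..t, X s) :
    ∀ t ∈ Icc 0 T, X t ≤ D * Real.exp (K * t) := by
  intro t ht
  have hD : 0 ≤ D := by
    have := h 0 ⟨le_rfl, ht.1.trans ht.2⟩
    simp only [intervalIntegral.integral_same, mul_zero, add_zero] at this
    exact (hX0 0).trans this
  have hder : ∀ s, HasDerivAt (fun r => D + K * ∫ u in (0 : ℝ)..r, X u) (K * X s) s := fun s =>
    ((intervalIntegral.integral_hasDerivAt_right (hX.intervalIntegrable _ _)
      (hX.stronglyMeasurableAtFilter _ _) hX.continuousAt).const_mul K).const_add D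
  have hg := norm_le_gronwallBound_of_norm_deriv_right_le
    (f := fun r => D + K * ∫ u in (0 : ℝ)..r, X u) (f' := fun s => K * X s) (δ := D)
    (K := K) (ε := 0) (a := 0) (b := T)
    (fun s _ => (hder s).continuousAt.continuousWithinAt)
    (fun s _ => (hder s).hasDerivWithinAt) (by simp [abs_of_nonneg hD]) (fun s hs => by
      rw [norm_mul, Real.norm_eq_abs, abs_of_nonneg hK, Real.norm_eq_abs, abs_of_nonneg (hX0 s),
        add_zero]
      exact mul_le_mul_of_nonneg_left ((h s ⟨hs.1, hs.2.le⟩).trans (le_abs_self _)) hK) t ht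
  rw [gronwallBound_ε0, sub_zero] at hg
  exact (h t ht).trans ((le_abs_self _).trans hg)

end Gronwall

/-! ### The abstract mild equation: bounds and contraction. -/

section MildEquation

variable {H : Type*} [NormedAddCommGroup H] [InnerProductSpace ℝ H]

/-- The conditions on the coordinates `a n s w` of a time dependent locally Lipschitz nonlinearity
under which the equation `c_n' = -k_n² c_n + a n s h`, `c_n = ⟪b n, h⟫`, is globally well posed. -/
structure IsMildNonlinearity (b : HilbertBasis ℕ ℝ H) (k : ℕ → ℝ) (T : ℝ) (V : ℝ → ℝ)
    (a : ℕ → ℝ → H → ℝ) (C A : ℝ) : Prop where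
  k_pos : ∀ n, 0 < k n
  summable : Summable fun n => (k n ^ 2)⁻¹
  V_memLp : MemLp V 2 (volume.restrict (Ioc 0 T))
  V_nonneg : ∀ s, 0 ≤ V s
  C_nonneg : 0 ≤ C
  A_nonneg : 0 ≤ A
  aestronglyMeasurable : ∀ n (h : ℝ → H), Continuous h →
    AEStronglyMeasurable (fun s => a n s (h s)) (volume.restrict (Ioc 0 T))
  bound_zero : ∀ᵐ s ∂(volume.restrict (Ioc 0 T)), ∀ n, |a n s 0| ≤ C * (k n + V s)
  lipschitz : ∀ᵐ s ∂(volume.restrict (Ioc 0 T)), ∀ n w z,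
    |a n s w - a n s z| ≤ C * (1 + ‖w‖ + ‖z‖) * (k n + V s) * ‖w - z‖
  -- The factor `θ` makes room for the radial cutoff: the nonlinearity sees the rescaled vector
  -- while the energy is tested against the unscaled one.
  energy : ∀ᵐ s ∂(volume.restrict (Ioc 0 T)), ∀ (N : ℕ) (c : ℕ → ℝ), ∀ θ ∈ Icc (0 : ℝ) 1,
    ∑ n ∈ Finset.range N,
        c n * (a n s (θ • ∑ j ∈ Finset.range N, c j • b j) - k n ^ 2 * c n) ≤
      A * (∑ n ∈ Finset.range N, c n ^ 2 + V s ^ 2)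

/-- The `n`-th coordinate at time `t` of the mild equation with initial value `η` and nonlinearity
evaluated along `u`. -/
def mildCoord (b : HilbertBasis ℕ ℝ H) (k : ℕ → ℝ) (a : ℕ → ℝ → H → ℝ) (η : H) (u : ℝ → H)
    (n : ℕ) (t : ℝ) : ℝ :=
  Real.exp (-(k n ^ 2 * t)) * inner ℝ (b n) η + duhamel (k n ^ 2) (fun s => a n s (u s)) t

namespace IsMildNonlinearity

variable {b : HilbertBasis ℕ ℝ H} {k : ℕ → ℝ} {T : ℝ} {V : ℝ → ℝ} {a : ℕ → ℝ → H → ℝ} {C A : ℝ}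

theorem bound (ha : IsMildNonlinearity b k T V a C A) {u : ℝ → H} {R : ℝ} (huR : ∀ s, ‖u s‖ ≤ R) :
    ∀ᵐ s ∂(volume.restrict (Ioc 0 T)), ∀ n,
      |a n s (u s)| ≤ C * (1 + (1 + R) * R) * (k n + V s) := by
  have hR : 0 ≤ R := (norm_nonneg _).trans (huR 0)
  filter_upwards [ha.bound_zero, ha.lipschitz] with s h0 h1 n
  have hk : 0 ≤ k n + V s := add_nonneg (ha.k_pos n).le (ha.V_nonneg s)
  have h2 := h1 n (u s) 0
  rw [norm_zero, add_zero, sub_zero] at h2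
  have h3 : C * (1 + ‖u s‖) * (k n + V s) * ‖u s‖ ≤ C * (1 + R) * (k n + V s) * R := by
    have := ha.C_nonneg
    have := huR s
    gcongr
  have h4 := abs_sub_abs_le_abs_sub (a n s (u s)) (a n s 0)
  linarith [h0 n]

theorem intervalIntegrable (ha : IsMildNonlinearity b k T V a C A) (hT : 0 ≤ T) {u : ℝ → H}
    (hu : Continuous u) {R : ℝ} (huR : ∀ s, ‖u s‖ ≤ R) (n : ℕ) :
    IntervalIntegrable (fun s => a n s (u s)) volume 0 T := by
  rw [intervalIntegrable_iff_integrableOn_Ioc_of_le hT]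
  have hg : Integrable (fun s => C * (1 + (1 + R) * R) * (k n + V s)) (volume.restrict (Ioc 0 T)) :=
    ((integrable_const _).add (ha.V_memLp.integrable (by norm_num))).const_mul _
  refine Integrable.mono' hg (ha.aestronglyMeasurable n u hu) ?_
  filter_upwards [ha.bound huR] with s hs
  exact hs n

/-- A square summable sequence that dominates the coordinates of the mild equation. -/
theorem exists_summable_sq_mildCoord_le (ha : IsMildNonlinearity b k T V a C A) (η : H)
    {u : ℝ → H} {R : ℝ} (huR : ∀ s, ‖u s‖ ≤ R) :
    ∃ d : ℕ → ℝ, Summable d ∧ (∀ n, 0 ≤ d n) ∧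
      ∀ n, ∀ t ∈ Icc 0 T, mildCoord b k a η u n t ^ 2 ≤ d n := by
  set W := ∫ s in Ioc 0 T, V s ^ 2
  have hW : 0 ≤ W := integral_nonneg fun s => sq_nonneg _
  set B := C * (1 + (1 + R) * R)
  refine ⟨fun n => 2 * inner ℝ (b n) η ^ 2 + 2 * (B ^ 2 * (2 + W) * (k n ^ 2)⁻¹), ?_, fun n => ?_,
    fun n t ht => ?_⟩
  · exact ((hasSum_sq_inner b η).summable.mul_left 2).add
      ((ha.summable.mul_left _).mul_left 2)
  · have := ha.k_pos n
    positivity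
  · have h1 : duhamel (k n ^ 2) (fun s => a n s (u s)) t ^ 2 ≤ B ^ 2 * (2 + W) * (k n ^ 2)⁻¹ := by
      -- The choice `l = 0` leaves the factor `1/k²`, summable over the modes.
      have h2 := sq_duhamel_le (α := fun s => a n s (u s)) (B := B) ha.V_memLp (ha.k_pos n) le_rfl
        ht (by
          filter_upwards [ha.bound huR] with s hs
          simpa using hs n)
      refine h2.trans (le_of_eq ?_)
      simp only [zero_mul, Real.exp_zero, mul_one, add_zero]
      rw [div_eq_mul_inv]; ring
    have h3 : (Real.exp (-(k n ^ 2 * t)) * inner ℝ (b n) η) ^ 2 ≤ inner ℝ (b n) η ^ 2 := by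
      rw [mul_pow]
      refine mul_le_of_le_one_left (sq_nonneg _) (pow_le_one₀ (Real.exp_pos _).le ?_)
      rw [Real.exp_le_one_iff]
      nlinarith [mul_nonneg (sq_nonneg (k n)) ht.1]
    rw [mildCoord]
    nlinarith [sq_nonneg (Real.exp (-(k n ^ 2 * t)) * inner ℝ (b n) η -
      duhamel (k n ^ 2) (fun s => a n s (u s)) t)]

/-- The set `S` of retained modes treats the full equation (`univ`) and the Galerkin truncations
(`Iio N`) together; the dominating sequence is the same for every `S`. -/
theorem exists_continuousMap_eq_mildCoord (ha : IsMildNonlinearity b k T V a C A) (hT : 0 ≤ T)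
    (η : H) {u : ℝ → H} (hu : Continuous u) {R : ℝ} (huR : ∀ s, ‖u s‖ ≤ R) (S : Set ℕ) :
    ∃ h : C(Icc (0 : ℝ) T, H), ∀ t n,
      inner ℝ (b n) (h t) = S.indicator (fun n => mildCoord b k a η u n t) n := by
  obtain ⟨d, hd, hd0, hle⟩ := ha.exists_summable_sq_mildCoord_le η huR
  refine exists_continuousMap_inner_basis_eq b
    (x := fun n (t : Icc (0 : ℝ) T) => S.indicator (fun n => mildCoord b k a η u n t) n)
    (fun n => ?_) hd fun n t => ?_
  · by_cases hn : n ∈ S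
    · simp only [indicator_of_mem hn]
      exact (continuousOn_exp_mul_add_duhamel _ _ hT
        (ha.intervalIntegrable hT hu huR n)).domRestrict
    · simp only [indicator_of_notMem hn]
      exact continuous_const
  · by_cases hn : n ∈ S
    · simpa only [indicator_of_mem hn] using hle n t t.2
    · simpa only [indicator_of_notMem hn, ne_eq, OfNat.ofNat_ne_zero, not_false_eq_true, zero_pow]
        using hd0 n

/-- The mild solution map contracts a suitable exponentially weighted norm on bounded sets. -/
theorem exists_weight (ha : IsMildNonlinearity b k T V a C A) (hT : 0 ≤ T) (R : ℝ) (hR : 0 ≤ R) :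
    ∃ l : ℝ, 0 ≤ l ∧ ∀ (η : H) (u w : ℝ → H), Continuous u → Continuous w →
      (∀ s, ‖u s‖ ≤ R) → (∀ s, ‖w s‖ ≤ R) → ∀ B, 0 ≤ B →
      (∀ s ∈ Icc 0 T, ‖u s - w s‖ ≤ 2 * (B * Real.exp (l * s))) →
      ∀ t ∈ Icc 0 T, ∀ (S : Set ℕ) (y : H),
        (∀ n, inner ℝ (b n) y = S.indicator (fun n => mildCoord b k a η u n t -
          mildCoord b k a η w n t) n) → ‖y‖ ≤ 1 / 2 * (B * Real.exp (l * t)) := by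
  set W := ∫ s in Ioc 0 T, V s ^ 2
  have hW : 0 ≤ W := integral_nonneg fun s => sq_nonneg _
  -- `C (1 + R + R)` bounds the local Lipschitz factor on the ball of radius `R`; the 2 is the
  -- Lipschitz constant of the radial cutoff.
  set K := C * (1 + R + R) * 2
  have hC := ha.C_nonneg
  have hK : 0 ≤ K := by positivity
  have hlim : Tendsto (fun l : ℝ => ∑' n, K ^ 2 * ((2 + W) / (k n ^ 2 + l))) atTop
      (𝓝 (∑' _ : ℕ, (0 : ℝ))) := by
    refine tendsto_tsum_of_dominated_convergence
      (bound := fun n => K ^ 2 * ((2 + W) * (k n ^ 2)⁻¹))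
      ((ha.summable.mul_left _).mul_left _) (fun n => ?_) ?_
    · have h1 : Tendsto (fun l : ℝ => (2 + W) / (k n ^ 2 + l)) atTop (𝓝 0) :=
        Tendsto.const_div_atTop (tendsto_atTop_add_const_left _ _ tendsto_id) _
      simpa using h1.const_mul (K ^ 2)
    · filter_upwards [eventually_ge_atTop (0 : ℝ)] with l hl n
      have := ha.k_pos n
      rw [Real.norm_eq_abs, abs_of_nonneg (by positivity), ← div_eq_mul_inv]
      gcongr
      linarith
  rw [tsum_zero] at hlim
  -- The bound is on squared norms, so `1/4` here becomes the contraction factor `1/2`.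
  obtain ⟨l, hl, hl0⟩ := ((hlim.eventually (ge_mem_nhds (show (0 : ℝ) < 1 / 4 by norm_num))).and
    (eventually_ge_atTop (0 : ℝ))).exists
  refine ⟨l, hl0, fun η u w hu hw huR hwR B hB huw t ht S y hy => ?_⟩
  have hsum : Summable fun n => K ^ 2 * ((2 + W) / (k n ^ 2 + l)) := by
    refine Summable.of_nonneg_of_le (fun n => ?_) (fun n => ?_)
      ((ha.summable.mul_left (2 + W)).mul_left (K ^ 2))
    · have := ha.k_pos n
      positivity
    · have := ha.k_pos n
      rw [← div_eq_mul_inv]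
      gcongr
      linarith
  have hdiff : ∀ n, mildCoord b k a η u n t - mildCoord b k a η w n t =
      duhamel (k n ^ 2) (fun s => a n s (u s) - a n s (w s)) t := fun n => by
    have hi : ∀ u : ℝ → H, Continuous u → (∀ s, ‖u s‖ ≤ R) → IntervalIntegrable
        (fun s => Real.exp (-(k n ^ 2 * (t - s))) * a n s (u s)) volume 0 t := fun u hu huR =>
      ((ha.intervalIntegrable hT hu huR n).mono_set (by
        rw [uIcc_of_le ht.1, uIcc_of_le hT]; exact Icc_subset_Icc_right ht.2)).continuousOn_mul
          (by fun_prop)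
    rw [mildCoord, mildCoord, add_sub_add_left_eq_sub, duhamel, duhamel, duhamel,
      ← intervalIntegral.integral_sub (hi u hu huR) (hi w hw hwR)]
    simp_rw [mul_sub]
  have hcoord : ∀ n, inner ℝ (b n) y ^ 2 ≤
      (B * Real.exp (l * t)) ^ 2 * (K ^ 2 * ((2 + W) / (k n ^ 2 + l))) := fun n => by
    have hk := ha.k_pos n
    rw [hy n]
    by_cases hn : n ∈ S
    · rw [indicator_of_mem hn, hdiff]
      have h1 := sq_duhamel_le (α := fun s => a n s (u s) - a n s (w s)) (B := K * B) ha.V_memLp hk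
        hl0 ht (by
          filter_upwards [ha.lipschitz, ae_restrict_mem measurableSet_Ioc] with s hs hsT
          refine (hs n (u s) (w s)).trans ?_
          have hkV : 0 ≤ k n + V s := add_nonneg hk.le (ha.V_nonneg s)
          have h2 := huw s ⟨hsT.1.le, hsT.2⟩
          have h3 := huR s
          have h4 := hwR s
          calc C * (1 + ‖u s‖ + ‖w s‖) * (k n + V s) * ‖u s - w s‖
              ≤ C * (1 + R + R) * (k n + V s) * (2 * (B * Real.exp (l * s))) := by gcongr
            _ = K * B * Real.exp (l * s) * (k n + V s) := by ring)
      refine h1.trans (le_of_eq ?_)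
      ring
    · rw [indicator_of_notMem hn, zero_pow two_ne_zero]
      have : 0 < k n ^ 2 + l := by positivity
      positivity
  have h1 := norm_sq_le_of_inner_basis b (hsum.mul_left _) hcoord
  rw [tsum_mul_left] at h1
  have h2 : 0 ≤ B * Real.exp (l * t) := by positivity
  refine abs_le_of_sq_le_sq' ?_ (by positivity) |>.2
  refine h1.trans ?_
  calc _ ≤ (B * Real.exp (l * t)) ^ 2 * (1 / 4) := mul_le_mul_of_nonneg_left hl (sq_nonneg _)
    _ = _ := by ring

end IsMildNonlinearity

end MildEquation

/-! ### Galerkin a priori bound and global well-posedness. -/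

namespace IsMildNonlinearity

variable {H : Type*} [NormedAddCommGroup H] [InnerProductSpace ℝ H]
  {b : HilbertBasis ℕ ℝ H} {k : ℕ → ℝ} {T : ℝ} {V : ℝ → ℝ} {a : ℕ → ℝ → H → ℝ} {C A : ℝ}

/-- The a priori bound for the truncated Galerkin approximations. -/
theorem norm_sq_le_of_galerkin (ha : IsMildNonlinearity b k T V a C A) (hT : 0 ≤ T) (η : H) {R : ℝ}
    (hR : 0 < R) (N : ℕ) (h : C(Icc (0 : ℝ) T, H))
    (hfix : ∀ t n, inner ℝ (b n) (h t) = (Iio N).indicator (fun n =>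
      mildCoord b k a η (fun s => radialCutoff R (IccExtend hT h s)) n t) n) (t : Icc (0 : ℝ) T) :
    ‖h t‖ ^ 2 ≤ (‖η‖ ^ 2 + 2 * A * ∫ s in Ioc 0 T, V s ^ 2) * Real.exp (2 * A * T) := by
  set W := ∫ s in Ioc 0 T, V s ^ 2
  have hW : 0 ≤ W := integral_nonneg fun s => sq_nonneg _
  have hA := ha.A_nonneg
  set x : ℝ → H := IccExtend hT h with hx_def
  have hx : Continuous x := h.continuous.Icc_extend'
  set u : ℝ → H := fun s => radialCutoff R (x s) with hu_def
  have hu : Continuous u := (continuous_radialCutoff hR).comp hx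
  have huR : ∀ s, ‖u s‖ ≤ R := fun s => norm_radialCutoff_le hR _
  set c : ℕ → ℝ → ℝ := fun n s => mildCoord b k a η u n s with hc_def
  have hcoord : ∀ s ∈ Icc 0 T, ∀ n, inner ℝ (b n) (x s) = (Iio N).indicator (fun n => c n s) n :=
    fun s hs n => by rw [hx_def, IccExtend_of_mem hT _ hs, hfix]
  have hxs : ∀ s ∈ Icc 0 T, x s = ∑ j ∈ Finset.range N, c j s • b j := fun s hs => by
    refine eq_of_inner_basis_eq b fun n => ?_
    rw [hcoord s hs, inner_sum]
    simp_rw [inner_smul_right, orthonormal_iff_ite.1 b.orthonormal n]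
    by_cases hn : n < N <;> simp [indicator, hn]
  have hnorm : ∀ s ∈ Icc 0 T, ‖x s‖ ^ 2 = ∑ n ∈ Finset.range N, c n s ^ 2 := fun s hs => by
    rw [← (hasSum_sq_inner b (x s)).tsum_eq, tsum_eq_sum (s := Finset.range N)]
    · refine Finset.sum_congr rfl fun n hn => ?_
      rw [hcoord s hs, indicator_of_mem (mem_Iio.2 (Finset.mem_range.1 hn))]
    · intro n hn
      rw [hcoord s hs, indicator_of_notMem (by simpa using hn), zero_pow two_ne_zero]
  have hη : ∑ n ∈ Finset.range N, inner ℝ (b n) η ^ 2 ≤ ‖η‖ ^ 2 :=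
    sum_le_hasSum _ (fun n _ => sq_nonneg _) (hasSum_sq_inner b η)
  have henergy : ∀ t ∈ Icc 0 T, ‖x t‖ ^ 2 ≤
      (‖η‖ ^ 2 + 2 * A * W) + 2 * A * ∫ s in (0 : ℝ)..t, ‖x s‖ ^ 2 := fun t ht => by
    have hsub : Ioc 0 t ⊆ Ioc 0 T := Ioc_subset_Ioc_right ht.2
    have hInt : ∀ n, IntervalIntegrable (fun s => a n s (u s)) volume 0 t := fun n =>
      (ha.intervalIntegrable hT hu huR n).mono_set (by
        rw [uIcc_of_le ht.1, uIcc_of_le hT]; exact Icc_subset_Icc_right ht.2)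
    have hcc : ∀ n, ContinuousOn (c n) (uIcc 0 t) := fun n => by
      rw [uIcc_of_le ht.1]
      have := continuousOn_exp_mul_add_duhamel (k n ^ 2) (inner ℝ (b n) η) ht.1 (hInt n)
      exact this
    have hInt2 : ∀ n, IntervalIntegrable
        (fun s => 2 * (c n s * (a n s (u s) - k n ^ 2 * c n s))) volume 0 t := fun n =>
      ((((hInt n).sub ((hcc n).intervalIntegrable.const_mul _)).continuousOn_mul
        (hcc n)).const_mul 2)
    -- Only finitely many modes are present, so the scalar energy identities may be summed with no
    -- regularity question.
    have h1 : ‖x t‖ ^ 2 = ∑ n ∈ Finset.range N, inner ℝ (b n) η ^ 2 +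
        ∫ s in (0 : ℝ)..t, ∑ n ∈ Finset.range N,
          2 * (c n s * (a n s (u s) - k n ^ 2 * c n s)) := by
      rw [hnorm t ht, intervalIntegral.integral_finsetSum fun n _ => hInt2 n,
        ← Finset.sum_add_distrib]
      refine Finset.sum_congr rfl fun n _ => ?_
      exact sq_exp_mul_add_duhamel (k n ^ 2) (inner ℝ (b n) η) (hInt n) fun s => rfl
    have hX : IntegrableOn (fun s => ‖x s‖ ^ 2) (Ioc 0 t) :=
      (hx.norm.pow 2).integrableOn_Ioc
    have hVt : IntegrableOn (fun s => V s ^ 2) (Ioc 0 t) :=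
      IntegrableOn.mono_set ha.V_memLp.integrable_sq hsub
    have h2 : ∫ s in (0 : ℝ)..t, ∑ n ∈ Finset.range N,
          2 * (c n s * (a n s (u s) - k n ^ 2 * c n s)) ≤
        ∫ s in Ioc 0 t, 2 * A * (‖x s‖ ^ 2 + V s ^ 2) := by
      rw [intervalIntegral.integral_of_le ht.1]
      refine integral_mono_ae ?_ ((hX.add hVt).const_mul _) ?_
      · rw [← IntegrableOn, ← intervalIntegrable_iff_integrableOn_Ioc_of_le ht.1]
        simpa only [Finset.sum_fn] using IntervalIntegrable.sum _ fun n _ => hInt2 n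
      · filter_upwards [ae_mono (Measure.restrict_mono_set _ hsub) ha.energy,
          ae_restrict_mem measurableSet_Ioc] with s hs hst
        have hsT : s ∈ Icc 0 T := ⟨hst.1.le, hst.2.trans ht.2⟩
        have hm : 0 < max R ‖x s‖ := lt_max_of_lt_left hR
        -- This `θ` is exactly the scaling performed by the radial cutoff, so the resulting bound
        -- does not depend on `R`.
        have h3 := hs N (fun n => c n s) (R / max R ‖x s‖) ⟨by positivity, by
          rw [div_le_one hm]; exact le_max_left _ _⟩
        rw [← hxs s hsT, ← hnorm s hsT] at h3
        have h4 : (R / max R ‖x s‖) • x s = u s := rfl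
        rw [h4] at h3
        rw [← Finset.mul_sum]
        linarith
    rw [integral_const_mul, integral_add hX hVt] at h2
    have h5 : ∫ s in Ioc 0 t, V s ^ 2 ≤ W :=
      setIntegral_mono_set ha.V_memLp.integrable_sq (ae_of_all _ fun s => sq_nonneg _)
        hsub.eventuallyLE
    rw [h1, intervalIntegral.integral_of_le ht.1 (f := fun s => ‖x s‖ ^ 2)]
    nlinarith [mul_le_mul_of_nonneg_left h5 hA]
  have hg := le_mul_exp_of_le_add_integral (X := fun s => ‖x s‖ ^ 2) (hx.norm.pow 2)
    (fun s => sq_nonneg _) (by positivity) henergy t t.2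
  simp only [hx_def, IccExtend_val] at hg
  refine hg.trans ?_
  have := t.2.2
  gcongr

/-- The solution maps of the truncated equation and of its Galerkin approximations contract a
common weighted norm. -/
theorem exists_truncated_solutionMap (ha : IsMildNonlinearity b k T V a C A) (hT : 0 ≤ T) (η : H)
    {R : ℝ} (hR : 0 < R) :
    ∃ (l : ℝ) (Φ : Set ℕ → C(Icc (0 : ℝ) T, H) → C(Icc (0 : ℝ) T, H)), 0 ≤ l ∧
      (∀ S h t n, inner ℝ (b n) (Φ S h t) = S.indicator (fun n =>
        mildCoord b k a η (fun s => radialCutoff R (IccExtend hT h s)) n t) n) ∧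
      ∀ S (h h' : C(Icc (0 : ℝ) T, H)) B, 0 ≤ B →
        (∀ t : Icc (0 : ℝ) T, ‖h t - h' t‖ ≤ B * Real.exp (l * t)) →
        ∀ t : Icc (0 : ℝ) T, ‖Φ S h t - Φ S h' t‖ ≤ 1 / 2 * (B * Real.exp (l * t)) := by
  obtain ⟨l, hl, hw⟩ := ha.exists_weight hT R hR.le
  have hu : ∀ h : C(Icc (0 : ℝ) T, H), Continuous fun s => radialCutoff R (IccExtend hT h s) :=
    fun h => (continuous_radialCutoff hR).comp h.continuous.Icc_extend'
  have huR : ∀ (h : C(Icc (0 : ℝ) T, H)) s, ‖radialCutoff R (IccExtend hT h s)‖ ≤ R :=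
    fun h s => norm_radialCutoff_le hR _
  choose Φ hΦ using fun S h => ha.exists_continuousMap_eq_mildCoord hT η (hu h) (huR h) S
  refine ⟨l, Φ, hl, hΦ, fun S h h' B hB hB' t => ?_⟩
  refine hw η _ _ (hu h) (hu h') (huR h) (huR h') B hB (fun s hs => ?_) t t.2 S _ fun n => ?_
  · refine (norm_radialCutoff_sub_le hR _ _).trans ?_
    rw [IccExtend_of_mem hT _ hs, IccExtend_of_mem hT _ hs]
    exact mul_le_mul_of_nonneg_left (hB' ⟨s, hs⟩) (by norm_num)
  · rw [inner_sub_right, hΦ, hΦ]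
    by_cases hn : n ∈ S <;> simp [hn]

/-- Global well-posedness of the mild equation. -/
theorem existsUnique_mild [CompleteSpace H] (ha : IsMildNonlinearity b k T V a C A) (hT : 0 ≤ T)
    (η : H) :
    ∃! h : C(Icc (0 : ℝ) T, H), ∀ t n,
      inner ℝ (b n) (h t) = mildCoord b k a η (IccExtend hT h) n t := by
  have hω : ∀ l : ℝ, ∃ ω : C(Icc (0 : ℝ) T, ℝ), ∀ t, ω t = Real.exp (l * t) := fun l =>
    ⟨⟨fun t => Real.exp (l * t), by fun_prop⟩, fun t => rfl⟩
  have hcut : ∀ (R : ℝ) (h : C(Icc (0 : ℝ) T, H)), 0 < R → (∀ t, ‖h t‖ ≤ R) →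
      (fun s => radialCutoff R (IccExtend hT h s)) = IccExtend hT h := fun R h hR hh =>
    funext fun s => radialCutoff_of_norm_le hR (hh _)
  refine existsUnique_of_exists_of_unique ?_ fun h h' hh hh' => ?_
  -- `D` is the Galerkin bound, independent of `R` and `N`, so `R` may be chosen after it; the added
  -- 1 guarantees `R > 0`.
  · set D := (‖η‖ ^ 2 + 2 * A * ∫ s in Ioc 0 T, V s ^ 2) * Real.exp (2 * A * T)
    set R := Real.sqrt D + 1
    have hR : 0 < R := by positivity
    obtain ⟨l, Φ, hl, hΦ, hcon⟩ := ha.exists_truncated_solutionMap hT η hR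
    obtain ⟨ω, hω⟩ := hω l
    have hfix : ∀ S, ∃ h, Φ S h = h := fun S =>
      (existsUnique_fixedPoint_of_weighted_contraction ω (fun t => by rw [hω]; positivity) (Φ S)
        (by simpa only [hω] using hcon S)).exists
    obtain ⟨h, hh⟩ := hfix univ
    choose g hg using fun N : ℕ => hfix (Iio N)
    have hcoord : ∀ t n, inner ℝ (b n) (h t) =
        mildCoord b k a η (fun s => radialCutoff R (IccExtend hT h s)) n t := fun t n => by
      conv_lhs => rw [← hh]
      rw [hΦ, indicator_univ]
    have hgle : ∀ N t, ‖g N t‖ ≤ Real.sqrt D := fun N t =>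
      Real.le_sqrt_of_sq_le (ha.norm_sq_le_of_galerkin hT η hR N (g N) (fun t n => by
        conv_lhs => rw [← hg N]
        rw [hΦ]) t)
    obtain ⟨d, hd, hd0, hle⟩ := ha.exists_summable_sq_mildCoord_le η
      (u := fun s => radialCutoff R (IccExtend hT h s)) (fun s => norm_radialCutoff_le hR _)
    set ε : ℕ → ℝ := fun N => Real.sqrt (∑' n, (Iio N)ᶜ.indicator d n)
    have hε : Tendsto ε atTop (𝓝 0) := by
      have : Tendsto (fun N : ℕ => ∑' n, (Iio N)ᶜ.indicator d n) atTop
          (𝓝 (∑' _ : ℕ, (0 : ℝ))) := by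
        refine tendsto_tsum_of_dominated_convergence hd (fun n => ?_)
          (Eventually.of_forall fun N n => ?_)
        · refine tendsto_const_nhds.congr' ?_
          filter_upwards [eventually_gt_atTop n] with N hN
          rw [indicator_of_notMem]
          simpa using hN
        · rw [Real.norm_eq_abs, abs_of_nonneg (indicator_nonneg (fun n _ => hd0 n) n)]
          exact indicator_le_self' (fun n _ => hd0 n) n
      rw [tsum_zero] at this
      simpa only [Real.sqrt_zero] using this.sqrt
    -- Since `h` is fixed by `Φ univ`, the map with `N` modes merely deletes its high modes, and the
    -- error is an `ℓ²` tail.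
    have htail : ∀ N t, ‖Φ (Iio N) h t - h t‖ ≤ ε N := fun N t => by
      refine Real.le_sqrt_of_sq_le (norm_sq_le_of_inner_basis b (hd.indicator _) fun n => ?_)
      rw [inner_sub_right, hΦ, hcoord]
      by_cases hn : n ∈ Iio N
      · rw [indicator_of_mem hn, sub_self, zero_pow two_ne_zero]
        exact indicator_nonneg (fun n _ => hd0 n) n
      · rw [indicator_of_notMem hn, zero_sub, neg_sq, indicator_of_mem hn]
        exact hle n t t.2
    have hdist : ∀ N t, ‖g N t - h t‖ ≤ 2 * ε N * Real.exp (l * T) := fun N t => by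
      have : Nonempty (Icc (0 : ℝ) T) := ⟨t⟩
      obtain ⟨t₀, -, ht₀⟩ := isCompact_univ.exists_isMaxOn (univ_nonempty (α := Icc (0 : ℝ) T))
        (f := fun t : Icc (0 : ℝ) T => ‖g N t - h t‖ * Real.exp (-(l * t)))
        (by fun_prop)
      set B := ‖g N t₀ - h t₀‖ * Real.exp (-(l * t₀)) with hB
      have hexp : ∀ (y : ℝ) (t : ℝ), y * Real.exp (-(l * t)) * Real.exp (l * t) = y := fun y t => by
        rw [mul_assoc, ← Real.exp_add]; simp
      have hall : ∀ t : Icc (0 : ℝ) T, ‖g N t - h t‖ ≤ B * Real.exp (l * t) := fun t => by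
        rw [← hexp ‖g N t - h t‖ t]
        exact mul_le_mul_of_nonneg_right (ht₀ (mem_univ t)) (Real.exp_pos _).le
      have hB0 : 0 ≤ B := by positivity
      -- At the maximum point of the weighted distance the contraction returns half of that very
      -- distance, so it can be absorbed on the left: the distance there is at most `2 ε N`.
      have h1 := hcon (Iio N) (g N) h B hB0 hall t₀
      rw [hg, hexp] at h1
      have h2 : ‖g N t₀ - h t₀‖ ≤ ‖g N t₀ - Φ (Iio N) h t₀‖ + ‖Φ (Iio N) h t₀ - h t₀‖ :=
        norm_sub_le_norm_sub_add_norm_sub _ _ _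
      have h3 : ‖g N t₀ - h t₀‖ ≤ 2 * ε N := by linarith [htail N t₀]
      have h4 : B ≤ 2 * ε N := by
        refine le_trans ?_ h3
        refine mul_le_of_le_one_right (norm_nonneg _) ?_
        rw [Real.exp_le_one_iff]
        linarith [mul_nonneg hl t₀.2.1]
      refine (hall t).trans ?_
      have := t.2.2
      gcongr
    have hbound : ∀ t, ‖h t‖ ≤ R := fun t => by
      have h1 : ∀ N, ‖h t‖ ≤ Real.sqrt D + 2 * ε N * Real.exp (l * T) := fun N => by
        have h2 := norm_sub_norm_le (h t) (g N t)
        rw [norm_sub_rev] at h2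
        linarith [hdist N t, hgle N t]
      have h3 : Tendsto (fun N => Real.sqrt D + 2 * ε N * Real.exp (l * T)) atTop
          (𝓝 (Real.sqrt D + 2 * 0 * Real.exp (l * T))) :=
        ((hε.const_mul 2).mul_const _).const_add _
      have h4 := ge_of_tendsto' h3 h1
      rw [mul_zero, zero_mul, add_zero] at h4
      linarith
    refine ⟨h, fun t n => ?_⟩
    rw [hcoord, hcut R h hR hbound]
  -- Both solutions stay where the cutoff is the identity, so both are fixed points of the same
  -- contraction.
  · set R := max ‖h‖ ‖h'‖ + 1
    have hR : 0 < R := by positivity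
    obtain ⟨l, Φ, hl, hΦ, hcon⟩ := ha.exists_truncated_solutionMap hT η hR
    obtain ⟨ω, hω⟩ := hω l
    have key : ∀ h : C(Icc (0 : ℝ) T, H), (∀ t n,
        inner ℝ (b n) (h t) = mildCoord b k a η (IccExtend hT h) n t) → ‖h‖ ≤ R →
        Φ univ h = h := fun h hh hhR => by
      ext t
      refine eq_of_inner_basis_eq b fun n => ?_
      rw [hΦ, indicator_univ, hcut R h hR fun t => (h.norm_coe_le_norm t).trans hhR, hh]
    exact (existsUnique_fixedPoint_of_weighted_contraction ω (fun t => by rw [hω]; positivity)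
      (Φ univ) (by simpa only [hω] using hcon univ)).unique
      (key h hh (by linarith [le_max_left ‖h‖ ‖h'‖]))
      (key h' hh' (by linarith [le_max_right ‖h‖ ‖h'‖]))

end IsMildNonlinearity

/-! ### The Dirichlet sine system and its completeness. -/

section SineBasis

/-- The frequencies `(n + 1) π`. -/
def sineFreq (n : ℕ) : ℝ := ((n : ℝ) + 1) * Real.pi

/-- The normalized Dirichlet eigenfunctions. -/
def sineFun (n : ℕ) (x : ℝ) : ℝ := Real.sqrt 2 * Real.sin (sineFreq n * x)

/-- The derivatives of the normalized Dirichlet eigenfunctions. -/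
def sineFunDeriv (n : ℕ) (x : ℝ) : ℝ := Real.sqrt 2 * (sineFreq n * Real.cos (sineFreq n * x))

theorem one_le_sineFreq (n : ℕ) : 1 ≤ sineFreq n := by
  have h1 : (1 : ℝ) ≤ (n : ℝ) + 1 := by linarith [Nat.cast_nonneg (α := ℝ) n]
  have h2 : (1 : ℝ) ≤ Real.pi := by linarith [Real.pi_gt_three]
  exact one_le_mul_of_one_le_of_one_le h1 h2

theorem sineFreq_pos (n : ℕ) : 0 < sineFreq n := one_pos.trans_le (one_le_sineFreq n)

theorem summable_inv_sineFreq_sq : Summable fun n => (sineFreq n ^ 2)⁻¹ := by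
  have h : Summable fun n : ℕ => (((n + 1 : ℕ) : ℝ) ^ 2)⁻¹ :=
    (summable_nat_add_iff 1).2 (Real.summable_nat_pow_inv.2 one_lt_two)
  refine (h.mul_right (Real.pi ^ 2)⁻¹).congr fun n => ?_
  rw [sineFreq, mul_pow, mul_inv]
  push_cast
  rfl

theorem continuous_sineFun (n : ℕ) : Continuous (sineFun n) := by
  unfold sineFun; fun_prop

theorem continuous_sineFunDeriv (n : ℕ) : Continuous (sineFunDeriv n) := by
  unfold sineFunDeriv; fun_prop

theorem hasDerivAt_sineFun (n : ℕ) (x : ℝ) : HasDerivAt (sineFun n) (sineFunDeriv n x) x := by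
  have h : HasDerivAt (fun x => sineFreq n * x) (sineFreq n * 1) x :=
    (hasDerivAt_id x).const_mul _
  refine (h.sin.const_mul (Real.sqrt 2)).congr_deriv ?_
  rw [sineFunDeriv]; ring

theorem abs_sineFun_le (n : ℕ) (x : ℝ) : |sineFun n x| ≤ Real.sqrt 2 := by
  rw [sineFun, abs_mul, abs_of_nonneg (Real.sqrt_nonneg 2)]
  exact mul_le_of_le_one_right (Real.sqrt_nonneg 2) (Real.abs_sin_le_one _)

theorem abs_sineFunDeriv_le (n : ℕ) (x : ℝ) : |sineFunDeriv n x| ≤ Real.sqrt 2 * sineFreq n := by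
  rw [sineFunDeriv, abs_mul, abs_of_nonneg (Real.sqrt_nonneg 2), abs_mul,
    abs_of_pos (sineFreq_pos n)]
  exact mul_le_mul_of_nonneg_left
    (mul_le_of_le_one_right (sineFreq_pos n).le (Real.abs_cos_le_one _)) (Real.sqrt_nonneg 2)

theorem sineFun_zero (n : ℕ) : sineFun n 0 = 0 := by simp [sineFun]

theorem sineFun_one (n : ℕ) : sineFun n 1 = 0 := by
  have : Real.sin (((n + 1 : ℕ) : ℝ) * Real.pi) = 0 := Real.sin_nat_mul_pi _
  push_cast at this
  simp [sineFun, sineFreq, this]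

theorem integral_cos_int_mul_pi {j : ℤ} (hj : j ≠ 0) :
    ∫ x in (0 : ℝ)..1, Real.cos ((j * Real.pi) * x) = 0 := by
  have : (j : ℝ) * Real.pi ≠ 0 := mul_ne_zero (by exact_mod_cast hj) Real.pi_ne_zero
  rw [intervalIntegral.integral_comp_mul_left (fun x => Real.cos x) this]
  simp [Real.sin_int_mul_pi]

theorem integral_sineFun_mul (n m : ℕ) :
    ∫ x in Icc (0 : ℝ) 1, sineFun n x * sineFun m x = if n = m then 1 else 0 := by
  rw [integral_Icc_eq_integral_Ioc, ← intervalIntegral.integral_of_le zero_le_one]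
  have h2 : Real.sqrt 2 * Real.sqrt 2 = 2 := Real.mul_self_sqrt (by norm_num)
  have h : ∀ x, sineFun n x * sineFun m x =
      Real.cos ((((n : ℤ) - m : ℤ) * Real.pi) * x) -
        Real.cos ((((n : ℤ) + m + 2 : ℤ) * Real.pi) * x) := fun x => by
    have h3 := Real.cos_sub_cos ((((n : ℤ) - m : ℤ) * Real.pi) * x)
      ((((n : ℤ) + m + 2 : ℤ) * Real.pi) * x)
    rw [h3, sineFun, sineFun, sineFreq, sineFreq]
    have h4 :
        ((((n : ℤ) - m : ℤ) : ℝ) * Real.pi * x - (((n : ℤ) + m + 2 : ℤ) : ℝ) * Real.pi * x) / 2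
        = -(((m : ℝ) + 1) * Real.pi * x) := by push_cast; ring
    have h5 :
        ((((n : ℤ) - m : ℤ) : ℝ) * Real.pi * x + (((n : ℤ) + m + 2 : ℤ) : ℝ) * Real.pi * x) / 2
        = ((n : ℝ) + 1) * Real.pi * x := by push_cast; ring
    rw [h4, h5, Real.sin_neg]
    linear_combination Real.sin (((n : ℝ) + 1) * Real.pi * x) *
      Real.sin (((m : ℝ) + 1) * Real.pi * x) * h2
  simp_rw [h]
  rw [intervalIntegral.integral_sub (Continuous.intervalIntegrable (by fun_prop) _ _)
    (Continuous.intervalIntegrable (by fun_prop) _ _), 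
    integral_cos_int_mul_pi (j := (n : ℤ) + m + 2) (by omega), sub_zero]
  split_ifs with hnm
  · simp [hnm]
  · exact integral_cos_int_mul_pi (by omega)

/-- An integrable function on `[0,1]` is determined by its sine coefficients. -/
theorem ae_eq_zero_of_sine_coeff_eq_zero {F : ℝ → ℝ} (hF : IntegrableOn F (Icc 0 1))
    (h : ∀ n, ∫ x in Icc (0 : ℝ) 1, F x * sineFun n x = 0) :
    ∀ᵐ x ∂(volume.restrict (Icc (0 : ℝ) 1)), F x = 0 := by
  have hInt : ∀ q : ℝ → ℝ, Continuous q → IntegrableOn (fun x => F x * q x) (Icc 0 1) :=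
    fun q hq => hF.mul_continuousOn hq.continuousOn isCompact_Icc
  have h0 : ∀ n : ℕ, ∫ x in Icc (0 : ℝ) 1, F x * Real.sin (sineFreq n * x) = 0 := fun n => by
    have h1 := h n
    simp_rw [sineFun, mul_left_comm _ (Real.sqrt 2), integral_const_mul] at h1
    exact (mul_eq_zero.1 h1).resolve_left (by positivity)
  -- Multiplying a sine mode by `cos(πx)` gives half the sum of the neighbouring modes, so vanishing
  -- propagates to all powers of the cosine; below the lowest mode the neighbour is zero.
  have hcos : ∀ j n : ℕ, ∫ x in Icc (0 : ℝ) 1,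
      F x * (Real.cos (Real.pi * x) ^ j * Real.sin (sineFreq n * x)) = 0 := by
    intro j
    induction j with
    | zero => simpa using h0
    | succ j ih =>
      have hstep : ∀ n : ℕ, ∀ x, Real.cos (Real.pi * x) * Real.sin (sineFreq n * x) =
          1 / 2 * Real.sin (sineFreq (n + 1) * x) +
            1 / 2 * Real.sin (sineFreq n * x - Real.pi * x) := fun n x => by
        have e : sineFreq (n + 1) * x = sineFreq n * x + Real.pi * x := by
          simp only [sineFreq]; push_cast; ring
        rw [e, Real.sin_add, Real.sin_sub]; ring
      intro n
      have e1 : ∀ x, F x * (Real.cos (Real.pi * x) ^ (j + 1) * Real.sin (sineFreq n * x)) =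
          1 / 2 * (F x * (Real.cos (Real.pi * x) ^ j * Real.sin (sineFreq (n + 1) * x))) +
          1 / 2 * (F x * (Real.cos (Real.pi * x) ^ j *
            Real.sin (sineFreq n * x - Real.pi * x))) := fun x => by
        rw [pow_succ, mul_assoc (Real.cos (Real.pi * x) ^ j), hstep]; ring
      simp_rw [e1]
      rw [integral_add ((hInt _ (by fun_prop)).const_mul _) ((hInt _ (by fun_prop)).const_mul _),
        integral_const_mul, integral_const_mul, ih (n + 1)]
      have h3 : ∫ x in Icc (0 : ℝ) 1, F x * (Real.cos (Real.pi * x) ^ j *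
          Real.sin (sineFreq n * x - Real.pi * x)) = 0 := by
        cases n with
        | zero => simp [sineFreq]
        | succ n =>
          have e : ∀ x, sineFreq (n + 1) * x - Real.pi * x = sineFreq n * x := fun x => by
            simp only [sineFreq]; push_cast; ring
          simp_rw [e]
          exact ih n
      rw [h3]; simp
  have hpoly : ∀ p : Polynomial ℝ, ∫ x in Icc (0 : ℝ) 1,
      F x * (p.eval (Real.cos (Real.pi * x)) * Real.sin (Real.pi * x)) = 0 := fun p => by
    simp_rw [Polynomial.eval_eq_sum_range, Finset.sum_mul, Finset.mul_sum]
    rw [integral_finsetSum _ fun i _ => hInt _ (by fun_prop)]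
    refine Finset.sum_eq_zero fun i _ => ?_
    have h1 := hcos i 0
    simp only [sineFreq, CharP.cast_eq_zero, zero_add, one_mul] at h1
    simp_rw [mul_assoc, mul_left_comm _ (p.coeff i), integral_const_mul, h1, mul_zero]
  have hcont : ∀ ψ : ℝ → ℝ, Continuous ψ → ∫ x in Icc (0 : ℝ) 1,
      F x * (ψ x * Real.sin (Real.pi * x)) = 0 := fun ψ hψ => by
    set J := ∫ x in Icc (0 : ℝ) 1, |F x|
    have hJ : 0 ≤ J := integral_nonneg fun x => abs_nonneg _
    refine abs_eq_zero.1 (le_antisymm (le_of_forall_pos_le_add fun ε hε => ?_) (abs_nonneg _))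
    rw [zero_add]
    -- On `[0,1]` every continuous `ψ` is a continuous function of `u = cos(πx)`, so Weierstrass
    -- applies on `[-1,1]`. The tolerance `ε/(J+1)` compensates the `L¹` norm `J` of `F`, the 1
    -- avoiding division by zero.
    obtain ⟨p, hp⟩ := exists_polynomial_near_of_continuousOn (-1) 1
      (fun u => ψ (Real.arccos u / Real.pi))
      (hψ.comp (Real.continuous_arccos.div_const _)).continuousOn (ε / (J + 1)) (by positivity)
    have e : ∫ x in Icc (0 : ℝ) 1, F x * (ψ x * Real.sin (Real.pi * x)) =
        ∫ x in Icc (0 : ℝ) 1, F x * ((ψ x - p.eval (Real.cos (Real.pi * x))) *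
          Real.sin (Real.pi * x)) := by
      simp_rw [sub_mul, mul_sub]
      rw [integral_sub (hInt _ (by fun_prop)) (hInt _ (by fun_prop)), hpoly p, sub_zero]
    rw [e, ← Real.norm_eq_abs]
    have h1 : ‖∫ x in Icc (0 : ℝ) 1, F x * ((ψ x - p.eval (Real.cos (Real.pi * x))) *
        Real.sin (Real.pi * x))‖ ≤ ∫ x in Icc (0 : ℝ) 1, ε / (J + 1) * |F x| := by
      refine norm_integral_le_of_norm_le (hF.abs.const_mul _) ?_
      filter_upwards [ae_restrict_mem measurableSet_Icc] with x hx
      have h2 := hp (Real.cos (Real.pi * x)) ⟨Real.neg_one_le_cos _, Real.cos_le_one _⟩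
      rw [Real.arccos_cos (mul_nonneg Real.pi_pos.le hx.1)
        (mul_le_of_le_one_right Real.pi_pos.le hx.2), mul_div_cancel_left₀ _ Real.pi_ne_zero,
        abs_sub_comm] at h2
      rw [norm_mul, norm_mul, Real.norm_eq_abs, Real.norm_eq_abs, Real.norm_eq_abs, mul_comm]
      refine mul_le_mul_of_nonneg_right ?_ (abs_nonneg _)
      exact (mul_le_of_le_one_right (abs_nonneg _) (Real.abs_sin_le_one _)).trans h2.le
    refine h1.trans ?_
    rw [integral_const_mul, div_mul_eq_mul_div, div_le_iff₀ (by positivity)]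
    nlinarith
  have hind : ∀ᵐ x, (Icc (0 : ℝ) 1).indicator (fun x => F x * Real.sin (Real.pi * x)) x = 0 := by
    refine ae_eq_zero_of_integral_contDiff_smul_eq_zero ?_ fun ψ hψ _ => ?_
    · exact ((hInt _ (by fun_prop)).integrable_indicator measurableSet_Icc).locallyIntegrable
    · refine Eq.trans ?_ (hcont ψ hψ.continuous)
      rw [← integral_indicator measurableSet_Icc]
      refine integral_congr_ae (ae_of_all _ fun x => ?_)
      by_cases hx : x ∈ Icc (0 : ℝ) 1
      · simp only [indicator_of_mem hx, smul_eq_mul]; ring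
      · simp only [indicator_of_notMem hx, smul_zero]
  have hIoo : ∀ᵐ x ∂(volume.restrict (Icc (0 : ℝ) 1)), x ∈ Ioo (0 : ℝ) 1 := by
    rw [← restrict_Ioo_eq_restrict_Icc]
    exact ae_restrict_mem measurableSet_Ioo
  filter_upwards [ae_restrict_of_ae hind, hIoo] with x hx hx'
  rw [indicator_of_mem (Ioo_subset_Icc_self hx')] at hx
  -- What has been shown to vanish is `F(x) sin(πx)`; the sine is positive in the open interval.
  refine (mul_eq_zero.1 hx).resolve_right (Real.sin_pos_of_pos_of_lt_pi ?_ ?_).ne'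
  · exact mul_pos Real.pi_pos hx'.1
  · exact mul_lt_of_lt_one_right Real.pi_pos hx'.2

theorem memLp_sineFun (n : ℕ) : MemLp (sineFun n) 2 (volume.restrict (Icc (0 : ℝ) 1)) :=
  MemLp.of_bound (continuous_sineFun n).aestronglyMeasurable (Real.sqrt 2)
    (ae_of_all _ fun x => abs_sineFun_le n x)

/-- The sine function `sineFun n` as an element of `L²([0,1])`. -/
def sineVec (n : ℕ) : L2I := (memLp_sineFun n).toLp

theorem coeFn_sineVec (n : ℕ) : sineVec n =ᵐ[volume.restrict (Icc (0 : ℝ) 1)] sineFun n :=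
  (memLp_sineFun n).coeFn_toLp

theorem inner_sineVec (n : ℕ) (w : L2I) :
    inner ℝ (sineVec n) w = ∫ x in Icc (0 : ℝ) 1, w x * sineFun n x := by
  rw [L2.inner_def]
  refine integral_congr_ae ?_
  filter_upwards [coeFn_sineVec n] with x hx
  rw [hx]
  simp

theorem orthonormal_sineVec : Orthonormal ℝ sineVec := by
  rw [orthonormal_iff_ite]
  intro n m
  rw [inner_sineVec, ← integral_sineFun_mul n m]
  refine integral_congr_ae ?_
  filter_upwards [coeFn_sineVec m] with x hx
  rw [hx, mul_comm]

theorem integrableOn_coeFn_L2I (w : L2I) : IntegrableOn w (Icc 0 1) :=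
  (Lp.memLp w).integrable (by norm_num)

theorem orthogonal_span_sineVec : (Submodule.span ℝ (range sineVec))ᗮ = ⊥ := by
  rw [Submodule.eq_bot_iff]
  intro w hw
  have h := ae_eq_zero_of_sine_coeff_eq_zero (integrableOn_coeFn_L2I w) fun n => by
    rw [← inner_sineVec]
    exact (Submodule.mem_orthogonal _ _).1 hw _ (Submodule.subset_span (mem_range_self n))
  rw [Lp.eq_zero_iff_ae_eq_zero]
  exact h

/-- The Hilbert basis of Dirichlet eigenfunctions of `L²([0,1])`. -/
def sineBasis : HilbertBasis ℕ ℝ L2I :=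
  HilbertBasis.mkOfOrthogonalEqBot orthonormal_sineVec orthogonal_span_sineVec

theorem inner_sineBasis (n : ℕ) (w : L2I) :
    inner ℝ (sineBasis n) w = ∫ x in Icc (0 : ℝ) 1, w x * sineFun n x := by
  rw [← inner_sineVec, sineBasis, HilbertBasis.coe_mkOfOrthogonalEqBot]

end SineBasis

/-! ### Estimates in `L²([0,1])` and measurable versions of curves. -/

section L2Bounds

theorem norm_sq_L2I (w : L2I) : ‖w‖ ^ 2 = ∫ x in Icc (0 : ℝ) 1, w x ^ 2 := by
  rw [← real_inner_self_eq_norm_sq, L2.inner_def]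
  refine integral_congr_ae (ae_of_all _ fun x => ?_)
  simp [sq]

theorem sqrt_integral_sq_L2I (w : L2I) : Real.sqrt (∫ x in Icc (0 : ℝ) 1, w x ^ 2) = ‖w‖ := by
  rw [← norm_sq_L2I, Real.sqrt_sq (norm_nonneg _)]

theorem integral_abs_mul_abs_le {α : Type*} [MeasurableSpace α] {μ : Measure α} {p q : α → ℝ}
    (hp : MemLp p 2 μ) (hq : MemLp q 2 μ) :
    ∫ x, |p x| * |q x| ∂μ ≤ Real.sqrt (∫ x, p x ^ 2 ∂μ) * Real.sqrt (∫ x, q x ^ 2 ∂μ) := by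
  rw [← Real.sqrt_mul (integral_nonneg fun x => sq_nonneg _)]
  refine Real.le_sqrt_of_sq_le ((sq_integral_mul_le hp.abs hq.abs).trans (le_of_eq ?_))
  simp only [Pi.abs_apply, sq_abs]

theorem integral_abs_L2I_le (w : L2I) : ∫ x in Icc (0 : ℝ) 1, |w x| ≤ ‖w‖ := by
  have h := integral_abs_mul_abs_le (memLp_const (1 : ℝ) (μ := volume.restrict (Icc (0 : ℝ) 1)))
    (Lp.memLp w)
  simpa [sqrt_integral_sq_L2I] using h

theorem integrable_abs_mul_abs_L2I (w z : L2I) :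
    IntegrableOn (fun x => |w x| * |z x|) (Icc 0 1) :=
  (Lp.memLp w).abs.integrable_mul (Lp.memLp z).abs

theorem integral_growth_mul_L2I_le (w z q : L2I) :
    ∫ x in Icc (0 : ℝ) 1, (1 + |w x| + |z x|) * |q x| ≤ (1 + ‖w‖ + ‖z‖) * ‖q‖ := by
  have h1 := integral_abs_mul_abs_le (Lp.memLp w) (Lp.memLp q)
  have h2 := integral_abs_mul_abs_le (Lp.memLp z) (Lp.memLp q)
  rw [sqrt_integral_sq_L2I, sqrt_integral_sq_L2I] at h1 h2
  simp_rw [add_mul, one_mul]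
  rw [integral_add (by exact (integrableOn_coeFn_L2I q).abs.add (integrable_abs_mul_abs_L2I w q))
    (integrable_abs_mul_abs_L2I z q),
    integral_add (integrableOn_coeFn_L2I q).abs (integrable_abs_mul_abs_L2I w q)]
  linarith [integral_abs_L2I_le q]

theorem integrable_growth_mul_L2I (w z q : L2I) :
    IntegrableOn (fun x => (1 + |w x| + |z x|) * |q x|) (Icc 0 1) := by
  simp_rw [add_mul, one_mul]
  exact ((integrableOn_coeFn_L2I q).abs.add (integrable_abs_mul_abs_L2I w q)).add
    (integrable_abs_mul_abs_L2I z q)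

theorem measurable_coeFn_L2I (w : L2I) : Measurable w := (Lp.stronglyMeasurable w).measurable

end L2Bounds

section JointlyMeasurableVersion

/-- On `[0,1]` the `L¹` norm is at most the `L²` norm, so the pointwise errors have an integrable
sum; it is finite almost everywhere and its terms tend to zero. -/
theorem ae_tendsto_of_norm_sub_le_geometric {w : ℕ → L2I} {z : L2I}
    (h : ∀ n, ‖w n - z‖ ≤ (1 / 2) ^ n) :
    ∀ᵐ y ∂(volume.restrict (Icc (0 : ℝ) 1)), Tendsto (fun n => w n y) atTop (𝓝 (z y)) := by
  have h1 : ∀ n, ∫⁻ y in Icc (0 : ℝ) 1, ‖(w n - z) y‖ₑ ≤ ENNReal.ofReal ((1 / 2) ^ n) := fun n => by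
    rw [← ofReal_integral_norm_eq_lintegral_enorm (integrableOn_coeFn_L2I _)]
    exact ENNReal.ofReal_le_ofReal ((integral_abs_L2I_le _).trans (h n))
  have h2 : ∫⁻ y in Icc (0 : ℝ) 1, ∑' n, ‖(w n - z) y‖ₑ ≠ ⊤ := by
    rw [lintegral_tsum fun n => (measurable_coeFn_L2I _).enorm.aemeasurable]
    refine ne_top_of_le_ne_top ?_ (ENNReal.tsum_le_tsum h1)
    rw [← ENNReal.ofReal_tsum_of_nonneg (fun n => by positivity)
      (summable_geometric_of_lt_one (by norm_num) (by norm_num))]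
    exact ENNReal.ofReal_ne_top
  have h3 := ae_lt_top (Measurable.tsum fun n => (measurable_coeFn_L2I (w n - z)).enorm) h2
  filter_upwards [h3, ae_all_iff.2 fun n => Lp.coeFn_sub (w n) z] with y hy hsub
  have h4 := ENNReal.tendsto_atTop_zero_of_tsum_ne_top hy.ne
  rw [tendsto_iff_edist_tendsto_0]
  refine h4.congr fun n => ?_
  rw [hsub n, Pi.sub_apply, edist_eq_enorm_sub]

/-- A continuous curve in `L²([0,1])` has a jointly measurable version. -/
theorem exists_measurable_version {u : ℝ → L2I} (hu : Continuous u) :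
    ∃ φ : ℝ × ℝ → ℝ, Measurable φ ∧
      ∀ s, ∀ᵐ y ∂(volume.restrict (Icc (0 : ℝ) 1)), u s y = φ (s, y) := by
  classical
  set d : ℕ → L2I := fun i => u (TopologicalSpace.denseSeq ℝ i)
  have hd : ∀ n : ℕ, ∀ s, ∃ i, dist (u s) (d i) < (1 / 2) ^ n := fun n s => by
    obtain ⟨_, hx, i, rfl⟩ := (TopologicalSpace.denseRange_denseSeq ℝ).inter_open_nonempty
      {r | dist (u s) (u r) < (1 / 2) ^ n} (isOpen_lt (by fun_prop) continuous_const)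
      ⟨s, by simp⟩
    exact ⟨i, hx⟩
  -- Taking the first member of a countable dense family within `2⁻ⁿ` of `u s` makes the
  -- approximating curve countably valued and measurable in `s`.
  set j : ℕ → ℝ → ℕ := fun n s => Nat.find (hd n s)
  have hj : ∀ n, Measurable (j n) := fun n => measurable_find (hd n) fun i =>
    (isOpen_lt (by fun_prop) continuous_const).measurableSet
  have hφ : ∀ n, Measurable fun p : ℝ × ℝ => d (j n p.1) p.2 := fun n => by
    have h1 : Measurable fun p : ℕ × ℝ => d p.1 p.2 :=
      measurable_from_prod_countable_right fun i => measurable_coeFn_L2I (d i)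
    exact h1.comp (((hj n).comp measurable_fst).prodMk measurable_snd)
  -- The `limsup` is measurable without any convergence and equals the limit wherever there is one.
  refine ⟨fun p => limsup (fun n => d (j n p.1) p.2) atTop, Measurable.limsup hφ, fun s => ?_⟩
  have h2 := ae_tendsto_of_norm_sub_le_geometric (w := fun n => d (j n s)) (z := u s) fun n => by
    rw [← dist_eq_norm, dist_comm]
    exact (Nat.find_spec (hd n s)).le
  filter_upwards [h2] with y hy
  exact hy.limsup_eq.symm

end JointlyMeasurableVersion

/-! ### The skeleton nonlinearity in sine coordinates. -/

section SkeletonNonlinearity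

/-- The consequences of the hypotheses on the coefficients of the skeleton equation that are used
below. -/
structure IsSkeletonCoefficients (T : ℝ) (f g σ : ℝ → ℝ → ℝ → ℝ) (K L M : ℝ) : Prop where
  K_nonneg : 0 ≤ K
  L_nonneg : 0 ≤ L
  M_nonneg : 0 ≤ M
  measurable_f : Measurable fun p : ℝ × ℝ × ℝ => f p.1 p.2.1 p.2.2
  measurable_g : Measurable fun p : ℝ × ℝ × ℝ => g p.1 p.2.1 p.2.2
  measurable_σ : Measurable fun p : ℝ × ℝ × ℝ => σ p.1 p.2.1 p.2.2
  f_growth : ∀ t ∈ Icc 0 T, ∀ x ∈ Icc (0 : ℝ) 1, ∀ r, |f t x r| ≤ K * (1 + |r|)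
  g_growth : ∀ t ∈ Icc 0 T, ∀ x ∈ Icc (0 : ℝ) 1, ∀ r, |g t x r| ≤ 3 * K * (1 + r ^ 2)
  -- Subtracting the value at `x = 0` cancels the part of `g` independent of `x`, so only linear
  -- growth remains. Thus `g t 0` can play the role of that part in the energy estimate.
  g_osc : ∀ t ∈ Icc 0 T, ∀ x ∈ Icc (0 : ℝ) 1, ∀ r, |g t x r - g t 0 r| ≤ 2 * K * (1 + |r|)
  σ_bdd : ∀ t ∈ Icc 0 T, ∀ x ∈ Icc (0 : ℝ) 1, ∀ r, |σ t x r| ≤ M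
  σ_lip : ∀ t ∈ Icc 0 T, ∀ x ∈ Icc (0 : ℝ) 1, ∀ p q, |σ t x p - σ t x q| ≤ L * |p - q|
  f_lip : ∀ t ∈ Icc 0 T, ∀ x ∈ Icc (0 : ℝ) 1, ∀ p q,
    |f t x p - f t x q| ≤ L * (1 + |p| + |q|) * |p - q|
  g_lip : ∀ t ∈ Icc 0 T, ∀ x ∈ Icc (0 : ℝ) 1, ∀ p q,
    |g t x p - g t x q| ≤ L * (1 + |p| + |q|) * |p - q|

/-- The sine coefficients of the right-hand side of the skeleton equation. -/
def skeletonCoeff {T : ℝ} (f g σ : ℝ → ℝ → ℝ → ℝ) (v : L2TI T) (n : ℕ) (s : ℝ) (w : L2I) : ℝ :=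
  -(∫ y in Icc (0 : ℝ) 1, g s y (w y) * sineFunDeriv n y) +
    (∫ y in Icc (0 : ℝ) 1, f s y (w y) * sineFun n y) +
    ∫ y in Icc (0 : ℝ) 1, σ s y (w y) * v (s, y) * sineFun n y

/-- The control on the time section of `v`. -/
def controlNorm {T : ℝ} (v : L2TI T) (s : ℝ) : ℝ :=
  1 + Real.sqrt (∫ y in Icc (0 : ℝ) 1, v (s, y) ^ 2)

variable {T : ℝ} (v : L2TI T)

theorem measurable_coeFn_L2TI : Measurable v := (Lp.stronglyMeasurable v).measurable

theorem integrable_sq_L2TI : Integrable (fun p => v p ^ 2)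
    ((volume.restrict (Icc (0 : ℝ) T)).prod (volume.restrict (Icc (0 : ℝ) 1))) := by
  rw [Measure.prod_restrict]
  exact (Lp.memLp v).integrable_sq

theorem ae_memLp_section_L2TI : ∀ᵐ s ∂(volume.restrict (Ioc (0 : ℝ) T)),
    MemLp (fun y => v (s, y)) 2 (volume.restrict (Icc (0 : ℝ) 1)) := by
  rw [restrict_Ioc_eq_restrict_Icc]
  filter_upwards [(integrable_sq_L2TI v).prod_right_ae] with s hs
  exact (memLp_two_iff_integrable_sq
    ((measurable_coeFn_L2TI v).comp measurable_prodMk_left).aestronglyMeasurable).2 hs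

theorem one_le_controlNorm (s : ℝ) : 1 ≤ controlNorm v s :=
  le_add_of_nonneg_right (Real.sqrt_nonneg _)

theorem memLp_controlNorm : MemLp (controlNorm v) 2 (volume.restrict (Ioc 0 T)) := by
  have hm : Measurable fun s => ∫ y in Icc (0 : ℝ) 1, v (s, y) ^ 2 :=
    (StronglyMeasurable.integral_prod_right'
      ((measurable_coeFn_L2TI v).pow_const 2).stronglyMeasurable).measurable
  refine (memLp_const (1 : ℝ)).add ?_
  rw [memLp_two_iff_integrable_sq hm.sqrt.aestronglyMeasurable]
  simp_rw [Real.sq_sqrt (integral_nonneg fun y => sq_nonneg (v (_, y)))]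
  rw [restrict_Ioc_eq_restrict_Icc]
  exact (integrable_sq_L2TI v).integral_prod_left

/-- The summand 1 in `controlNorm` lets its square absorb the additive constants of the energy
estimate. -/
theorem one_add_integral_sq_le_controlNorm_sq (s : ℝ) :
    1 + ∫ y in Icc (0 : ℝ) 1, v (s, y) ^ 2 ≤ controlNorm v s ^ 2 := by
  have h : 0 ≤ ∫ y in Icc (0 : ℝ) 1, v (s, y) ^ 2 := integral_nonneg fun y => sq_nonneg _
  rw [controlNorm]
  nlinarith [Real.sq_sqrt h, Real.sqrt_nonneg (∫ y in Icc (0 : ℝ) 1, v (s, y) ^ 2)]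

theorem abs_integral_mul_sub_le {p q e D : ℝ → ℝ} {B : ℝ} (hp : IntegrableOn p (Icc 0 1))
    (hq : IntegrableOn q (Icc 0 1)) (he : Continuous e) (heB : ∀ y, |e y| ≤ B)
    (hD : IntegrableOn D (Icc 0 1))
    (h : ∀ᵐ y ∂(volume.restrict (Icc (0 : ℝ) 1)), |p y - q y| ≤ D y) :
    |(∫ y in Icc (0 : ℝ) 1, p y * e y) - ∫ y in Icc (0 : ℝ) 1, q y * e y| ≤
      B * ∫ y in Icc (0 : ℝ) 1, D y := by
  rw [← integral_sub (hp.mul_continuousOn he.continuousOn isCompact_Icc)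
    (hq.mul_continuousOn he.continuousOn isCompact_Icc), ← integral_const_mul, ← Real.norm_eq_abs]
  refine norm_integral_le_of_norm_le (hD.const_mul _) ?_
  filter_upwards [h] with y hy
  rw [← sub_mul, norm_mul, Real.norm_eq_abs, Real.norm_eq_abs, mul_comm]
  exact mul_le_mul (heB y) hy (abs_nonneg _) ((abs_nonneg _).trans (heB y))

/-- Orthogonality of the derivatives identifies the dissipation `∑ k_n² c_n²` with `∫ W'²` for a
sine polynomial `W`. -/
theorem integral_sineFunDeriv_mul (n m : ℕ) :
    ∫ x in Icc (0 : ℝ) 1, sineFunDeriv n x * sineFunDeriv m x =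
      if n = m then sineFreq n ^ 2 else 0 := by
  rw [integral_Icc_eq_integral_Ioc, ← intervalIntegral.integral_of_le zero_le_one]
  have h2 : Real.sqrt 2 * Real.sqrt 2 = 2 := Real.mul_self_sqrt (by norm_num)
  have h : ∀ x, sineFunDeriv n x * sineFunDeriv m x = sineFreq n * sineFreq m *
      (Real.cos ((((n : ℤ) - m : ℤ) * Real.pi) * x) +
        Real.cos ((((n : ℤ) + m + 2 : ℤ) * Real.pi) * x)) := fun x => by
    have h3 : (((n : ℤ) - m : ℤ) : ℝ) * Real.pi * x = sineFreq n * x - sineFreq m * x := by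
      rw [sineFreq, sineFreq]; push_cast; ring
    have h4 : (((n : ℤ) + m + 2 : ℤ) : ℝ) * Real.pi * x = sineFreq n * x + sineFreq m * x := by
      rw [sineFreq, sineFreq]; push_cast; ring
    rw [h3, h4, Real.cos_sub, Real.cos_add, sineFunDeriv, sineFunDeriv]
    linear_combination sineFreq n * sineFreq m * Real.cos (sineFreq n * x) *
      Real.cos (sineFreq m * x) * h2
  simp_rw [h]
  rw [intervalIntegral.integral_const_mul,
    intervalIntegral.integral_add (Continuous.intervalIntegrable (by fun_prop) _ _)
    (Continuous.intervalIntegrable (by fun_prop) _ _),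
    integral_cos_int_mul_pi (j := (n : ℤ) + m + 2) (by omega), add_zero]
  split_ifs with hnm
  · simp [hnm, sq]
  · rw [integral_cos_int_mul_pi (by omega), mul_zero]

/-- The integrand is the derivative of `Q(W)` for a primitive `Q` of `q`, with equal boundary
values. This is the cancellation that makes quadratic growth of `g` harmless. -/
theorem integral_comp_mul_deriv_eq_zero {q W W' : ℝ → ℝ} (hq : Continuous q)
    (hW : ∀ y, HasDerivAt W (W' y) y) (hW' : Continuous W') (h01 : W 0 = W 1) :
    ∫ y in Icc (0 : ℝ) 1, q (W y) * W' y = 0 := by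
  rw [integral_Icc_eq_integral_Ioc, ← intervalIntegral.integral_of_le zero_le_one]
  have h := intervalIntegral.integral_comp_mul_deriv (a := 0) (b := 1) (f := W) (f' := W') (g := q)
    (fun y _ => hW y) hW'.continuousOn hq
  rw [h01, intervalIntegral.integral_same] at h
  exact h

theorem continuous_of_locally_lipschitz_bound {q : ℝ → ℝ} {L : ℝ}
    (hq : ∀ x y, |q x - q y| ≤ L * (1 + |x| + |y|) * |x - y|) : Continuous q := by
  refine continuous_iff_continuousAt.2 fun y => ?_
  rw [ContinuousAt, tendsto_iff_dist_tendsto_zero]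
  refine squeeze_zero (fun x => dist_nonneg) (fun x => hq x y) ?_
  have : Tendsto (fun x : ℝ => L * (1 + |x| + |y|) * |x - y|) (𝓝 y)
      (𝓝 (L * (1 + |y| + |y|) * |y - y|)) :=
    Continuous.tendsto (f := fun x : ℝ => L * (1 + |x| + |y|) * |x - y|) (by fun_prop) y
  simpa using this

namespace IsSkeletonCoefficients

variable {v} {f g σ : ℝ → ℝ → ℝ → ℝ} {K L M : ℝ}

theorem integrableOn_f (hc : IsSkeletonCoefficients T f g σ K L M) {s : ℝ} (hs : s ∈ Icc 0 T)
    {w : ℝ → ℝ} (hw : Measurable w) (hw2 : MemLp w 2 (volume.restrict (Icc (0 : ℝ) 1))) :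
    IntegrableOn (fun y => f s y (w y)) (Icc 0 1) := by
  have hInt : IntegrableOn (fun y => K * (1 + |w y|)) (Icc 0 1) :=
    ((integrable_const _).add (hw2.integrable (by norm_num)).abs).const_mul _
  refine Integrable.mono' hInt (hc.measurable_f.comp
    (measurable_const.prodMk (measurable_id.prodMk hw))).aestronglyMeasurable ?_
  filter_upwards [ae_restrict_mem measurableSet_Icc] with y hy
  exact hc.f_growth s hs y hy _

theorem integrableOn_g (hc : IsSkeletonCoefficients T f g σ K L M) {s : ℝ} (hs : s ∈ Icc 0 T)
    {w : ℝ → ℝ} (hw : Measurable w) (hw2 : MemLp w 2 (volume.restrict (Icc (0 : ℝ) 1))) :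
    IntegrableOn (fun y => g s y (w y)) (Icc 0 1) := by
  have hInt : IntegrableOn (fun y => 3 * K * (1 + w y ^ 2)) (Icc 0 1) :=
    ((integrable_const _).add hw2.integrable_sq).const_mul _
  refine Integrable.mono' hInt (hc.measurable_g.comp
    (measurable_const.prodMk (measurable_id.prodMk hw))).aestronglyMeasurable ?_
  filter_upwards [ae_restrict_mem measurableSet_Icc] with y hy
  exact hc.g_growth s hs y hy _

theorem integrableOn_σ_mul (hc : IsSkeletonCoefficients T f g σ K L M) {s : ℝ} (hs : s ∈ Icc 0 T)
    {w : ℝ → ℝ} (hw : Measurable w)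
    (hv : MemLp (fun y => v (s, y)) 2 (volume.restrict (Icc (0 : ℝ) 1))) :
    IntegrableOn (fun y => σ s y (w y) * v (s, y)) (Icc 0 1) := by
  have hv1 := hv.integrable (by norm_num)
  refine Integrable.mono' (hv1.abs.const_mul M) (AEStronglyMeasurable.mul (hc.measurable_σ.comp
    (measurable_const.prodMk (measurable_id.prodMk hw))).aestronglyMeasurable
    hv1.aestronglyMeasurable) ?_
  filter_upwards [ae_restrict_mem measurableSet_Icc] with y hy
  rw [Real.norm_eq_abs, abs_mul]
  exact mul_le_mul_of_nonneg_right (hc.σ_bdd s hs y hy _) (abs_nonneg _)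

/-- The test functions are bounded, so `L¹` control of the differences is enough, and Cauchy–Schwarz
turns the linearly growing Lipschitz factor into `(1 + ‖w‖ + ‖z‖) ‖w - z‖`. The cosine tests of `g`
produce `sineFreq n`; the product with `v` produces the `L²` norm of its section. -/
theorem skeletonCoeff_lipschitz (hc : IsSkeletonCoefficients T f g σ K L M) {s : ℝ}
    (hs : s ∈ Icc 0 T) (hv : MemLp (fun y => v (s, y)) 2 (volume.restrict (Icc (0 : ℝ) 1)))
    (n : ℕ) (w z : L2I) :
    |skeletonCoeff f g σ v n s w - skeletonCoeff f g σ v n s z| ≤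
      Real.sqrt 2 * L * (1 + ‖w‖ + ‖z‖) * (sineFreq n + controlNorm v s) * ‖w - z‖ := by
  have hL := hc.L_nonneg
  have hk := sineFreq_pos n
  have hwm := measurable_coeFn_L2I w
  have hzm := measurable_coeFn_L2I z
  have hD := (integrable_growth_mul_L2I w z (w - z)).const_mul L
  have hDle := integral_growth_mul_L2I_le w z (w - z)
  have hg := abs_integral_mul_sub_le (hc.integrableOn_g hs hwm (Lp.memLp w))
    (hc.integrableOn_g hs hzm (Lp.memLp z)) (continuous_sineFunDeriv n) (abs_sineFunDeriv_le n) hD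
    (by
      filter_upwards [ae_restrict_mem measurableSet_Icc, Lp.coeFn_sub w z] with y hy hsub
      rw [hsub, Pi.sub_apply, ← mul_assoc]
      exact hc.g_lip s hs y hy _ _)
  have hf := abs_integral_mul_sub_le (hc.integrableOn_f hs hwm (Lp.memLp w))
    (hc.integrableOn_f hs hzm (Lp.memLp z)) (continuous_sineFun n) (abs_sineFun_le n) hD
    (by
      filter_upwards [ae_restrict_mem measurableSet_Icc, Lp.coeFn_sub w z] with y hy hsub
      rw [hsub, Pi.sub_apply, ← mul_assoc]
      exact hc.f_lip s hs y hy _ _)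
  have hσ := abs_integral_mul_sub_le (hc.integrableOn_σ_mul hs hwm hv)
    (hc.integrableOn_σ_mul hs hzm hv) (continuous_sineFun n) (abs_sineFun_le n)
    (D := fun y => L * (|(w - z) y| * |v (s, y)|))
    (((Lp.memLp (w - z)).abs.integrable_mul hv.abs).const_mul L)
    (by
      filter_upwards [ae_restrict_mem measurableSet_Icc, Lp.coeFn_sub w z] with y hy hsub
      rw [hsub, Pi.sub_apply, ← mul_assoc, ← sub_mul, abs_mul]
      exact mul_le_mul_of_nonneg_right (hc.σ_lip s hs y hy _ _) (abs_nonneg _))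
  have hσle := integral_abs_mul_abs_le (Lp.memLp (w - z)) hv
  rw [sqrt_integral_sq_L2I] at hσle
  rw [integral_const_mul] at hg hf hσ
  have h2 := Real.sqrt_nonneg 2
  set r := Real.sqrt 2
  set X := ∫ x in Icc (0 : ℝ) 1, (1 + |w x| + |z x|) * |(w - z) x|
  set Y := ∫ x in Icc (0 : ℝ) 1, |(w - z) x| * |v (s, x)|
  set S := Real.sqrt (∫ y in Icc (0 : ℝ) 1, v (s, y) ^ 2) with hS
  have hS0 : 0 ≤ S := Real.sqrt_nonneg _
  have hgX : r * sineFreq n * (L * X) ≤ r * sineFreq n * (L * ((1 + ‖w‖ + ‖z‖) * ‖w - z‖)) := by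
    gcongr
  have hfX : r * (L * X) ≤ r * (L * ((1 + ‖w‖ + ‖z‖) * ‖w - z‖)) := by gcongr
  have hσY : r * (L * Y) ≤ r * (L * ((1 + ‖w‖ + ‖z‖) * ‖w - z‖ * S)) := by
    have : ‖w - z‖ * S ≤ (1 + ‖w‖ + ‖z‖) * ‖w - z‖ * S := by
      refine mul_le_mul_of_nonneg_right (le_mul_of_one_le_left (norm_nonneg _) ?_) hS0
      linarith [norm_nonneg w, norm_nonneg z]
    have := hσle.trans this
    gcongr
  have hV : controlNorm v s = 1 + S := rfl
  rw [skeletonCoeff, skeletonCoeff, hV]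
  rw [abs_le] at hg hf hσ ⊢
  constructor <;> nlinarith

theorem skeletonCoeff_zero_le (hc : IsSkeletonCoefficients T f g σ K L M) {s : ℝ}
    (hs : s ∈ Icc 0 T) (hv : MemLp (fun y => v (s, y)) 2 (volume.restrict (Icc (0 : ℝ) 1)))
    (n : ℕ) :
    |skeletonCoeff f g σ v n s 0| ≤
      Real.sqrt 2 * (3 * K + M) * (sineFreq n + controlNorm v s) := by
  have hK := hc.K_nonneg
  have hM := hc.M_nonneg
  have hk := sineFreq_pos n
  have h0m := measurable_coeFn_L2I 0
  have h0 : IntegrableOn (fun _ : ℝ => (0 : ℝ)) (Icc 0 1) := integrableOn_zero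
  have hz := Lp.coeFn_zero ℝ 2 (volume.restrict (Icc (0 : ℝ) 1))
  have hg := abs_integral_mul_sub_le (hc.integrableOn_g hs h0m (Lp.memLp 0)) h0
    (continuous_sineFunDeriv n) (abs_sineFunDeriv_le n) (D := fun _ => 3 * K)
    (integrable_const _) (by
      filter_upwards [ae_restrict_mem measurableSet_Icc, hz] with y hy hsub
      have := hc.g_growth s hs y hy 0
      rw [hsub]
      simpa using this)
  have hf := abs_integral_mul_sub_le (hc.integrableOn_f hs h0m (Lp.memLp 0)) h0
    (continuous_sineFun n) (abs_sineFun_le n) (D := fun _ => K)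
    (integrable_const _) (by
      filter_upwards [ae_restrict_mem measurableSet_Icc, hz] with y hy hsub
      have := hc.f_growth s hs y hy 0
      rw [hsub]
      simpa using this)
  have hσ := abs_integral_mul_sub_le (hc.integrableOn_σ_mul hs h0m hv) h0
    (continuous_sineFun n) (abs_sineFun_le n) (D := fun y => M * (|1| * |v (s, y)|))
    (((memLp_const (1 : ℝ) (p := 2)).abs.integrable_mul hv.abs).const_mul M) (by
      filter_upwards [ae_restrict_mem measurableSet_Icc] with y hy
      rw [sub_zero, abs_mul, abs_one, one_mul]
      exact mul_le_mul_of_nonneg_right (hc.σ_bdd s hs y hy _) (abs_nonneg _))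
  have hσle := integral_abs_mul_abs_le (memLp_const (1 : ℝ)) hv
  simp only [zero_mul, integral_zero, sub_zero] at hg hf hσ
  rw [integral_const_mul] at hσ
  have h1 : ∫ _ in Icc (0 : ℝ) 1, (1 : ℝ) ^ 2 = 1 := by simp
  have h3 : ∫ _ in Icc (0 : ℝ) 1, 3 * K = 3 * K := by simp
  have h4 : ∫ _ in Icc (0 : ℝ) 1, K = K := by simp
  rw [h1, Real.sqrt_one, one_mul] at hσle
  rw [h3] at hg
  rw [h4] at hf
  have h2 := Real.sqrt_nonneg 2
  set r := Real.sqrt 2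
  set Y := ∫ x in Icc (0 : ℝ) 1, |(1 : ℝ)| * |v (s, x)|
  set S := Real.sqrt (∫ y in Icc (0 : ℝ) 1, v (s, y) ^ 2) with hS
  have hS0 : 0 ≤ S := Real.sqrt_nonneg _
  have hσY : r * (M * Y) ≤ r * (M * S) := by gcongr
  have hV : controlNorm v s = 1 + S := rfl
  have e1 : 0 ≤ r * K := mul_nonneg h2 hK
  have e2 : 0 ≤ r * K * S := mul_nonneg e1 hS0
  have e3 : 0 ≤ r * M * sineFreq n := by positivity
  have e4 : 0 ≤ r * M := by positivity
  rw [skeletonCoeff, hV]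
  rw [abs_le] at hg hf hσ ⊢
  constructor <;> nlinarith

/-- The inner integrals see only the class of `u s` for each `s`, so a jointly measurable version
may replace it. -/
theorem aestronglyMeasurable_skeletonCoeff (hc : IsSkeletonCoefficients T f g σ K L M) (n : ℕ)
    {u : ℝ → L2I} (hu : Continuous u) (μ : Measure ℝ) :
    AEStronglyMeasurable (fun s => skeletonCoeff f g σ v n s (u s)) μ := by
  obtain ⟨φ, hφ, hφu⟩ := exists_measurable_version hu
  have hcomp : Measurable fun p : ℝ × ℝ => ((p.1, p.2, φ p) : ℝ × ℝ × ℝ) :=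
    measurable_fst.prodMk (measurable_snd.prodMk hφ)
  have h : (fun s => skeletonCoeff f g σ v n s (u s)) = fun s =>
      -(∫ y in Icc (0 : ℝ) 1, g s y (φ (s, y)) * sineFunDeriv n y) +
        (∫ y in Icc (0 : ℝ) 1, f s y (φ (s, y)) * sineFun n y) +
        ∫ y in Icc (0 : ℝ) 1, σ s y (φ (s, y)) * v (s, y) * sineFun n y := by
    funext s
    rw [skeletonCoeff]
    congr 1
    · congr 1
      · congr 1
        refine integral_congr_ae ?_
        filter_upwards [hφu s] with y hy
        rw [hy]
      · refine integral_congr_ae ?_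
        filter_upwards [hφu s] with y hy
        rw [hy]
    · refine integral_congr_ae ?_
      filter_upwards [hφu s] with y hy
      rw [hy]
  rw [h]
  have hg : Measurable fun p : ℝ × ℝ => g p.1 p.2 (φ p) * sineFunDeriv n p.2 :=
    (hc.measurable_g.comp hcomp).mul ((continuous_sineFunDeriv n).measurable.comp measurable_snd)
  have hf : Measurable fun p : ℝ × ℝ => f p.1 p.2 (φ p) * sineFun n p.2 :=
    (hc.measurable_f.comp hcomp).mul ((continuous_sineFun n).measurable.comp measurable_snd)
  have hσ : Measurable fun p : ℝ × ℝ => σ p.1 p.2 (φ p) * v p * sineFun n p.2 :=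
    ((hc.measurable_σ.comp hcomp).mul (measurable_coeFn_L2TI v)).mul
      ((continuous_sineFun n).measurable.comp measurable_snd)
  exact ((hg.stronglyMeasurable.integral_prod_right'.neg.add
    hf.stronglyMeasurable.integral_prod_right').add
    hσ.stronglyMeasurable.integral_prod_right').aestronglyMeasurable

end IsSkeletonCoefficients

end SkeletonNonlinearity

/-! ### Trigonometric polynomials and the energy estimate. -/

section TrigonometricPolynomials

theorem integral_sq_sum_of_orthogonal {ψ : ℕ → ℝ → ℝ} {κ : ℕ → ℝ} (hψ : ∀ n, Continuous (ψ n))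
    (h : ∀ n m, ∫ y in Icc (0 : ℝ) 1, ψ n y * ψ m y = if n = m then κ n else 0) (N : ℕ)
    (c : ℕ → ℝ) :
    ∫ y in Icc (0 : ℝ) 1, (∑ n ∈ Finset.range N, c n * ψ n y) ^ 2 =
      ∑ n ∈ Finset.range N, κ n * c n ^ 2 := by
  have hInt : ∀ n m, IntegrableOn (fun y => c n * ψ n y * (c m * ψ m y)) (Icc 0 1) := fun n m =>
    Continuous.integrableOn_Icc
      ((continuous_const.mul (hψ n)).mul (continuous_const.mul (hψ m)))
  simp_rw [sq, Finset.sum_mul_sum]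
  rw [integral_finsetSum _ fun n _ => integrable_finsetSum _ fun m _ => hInt n m]
  refine Finset.sum_congr rfl fun n hn => ?_
  rw [integral_finsetSum _ fun m _ => hInt n m]
  have h1 : ∀ m, ∫ y in Icc (0 : ℝ) 1, c n * ψ n y * (c m * ψ m y) =
      if n = m then κ n * (c n * c n) else 0 := fun m => by
    have e : ∀ y, c n * ψ n y * (c m * ψ m y) = c n * c m * (ψ n y * ψ m y) := fun y => by ring
    simp_rw [e]
    rw [integral_const_mul, h]
    split_ifs with hnm
    · rw [← hnm]; ring
    · ring
  simp_rw [h1, Finset.sum_ite_eq, if_pos hn]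

theorem sum_mul_integral_mul {p : ℝ → ℝ} {ψ : ℕ → ℝ → ℝ} (hp : IntegrableOn p (Icc 0 1))
    (hψ : ∀ n, Continuous (ψ n)) (N : ℕ) (c : ℕ → ℝ) :
    ∑ n ∈ Finset.range N, c n * ∫ y in Icc (0 : ℝ) 1, p y * ψ n y =
      ∫ y in Icc (0 : ℝ) 1, p y * ∑ n ∈ Finset.range N, c n * ψ n y := by
  simp_rw [Finset.mul_sum, mul_left_comm _ (c _)]
  rw [integral_finsetSum _ fun n _ =>
    (hp.mul_continuousOn (hψ n).continuousOn isCompact_Icc).const_mul (c n)]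
  simp_rw [integral_const_mul]

theorem coeFn_sum_sineBasis (N : ℕ) (c : ℕ → ℝ) :
    ∀ᵐ y ∂(volume.restrict (Icc (0 : ℝ) 1)),
      (∑ j ∈ Finset.range N, c j • sineBasis j : L2I) y =
        ∑ j ∈ Finset.range N, c j * sineFun j y := by
  induction N with
  | zero =>
    filter_upwards [Lp.coeFn_zero ℝ 2 (volume.restrict (Icc (0 : ℝ) 1))] with y hy
    simpa using hy
  | succ N ih =>
    have hb : sineBasis N = sineVec N := by rw [sineBasis, HilbertBasis.coe_mkOfOrthogonalEqBot]
    rw [Finset.sum_range_succ]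
    filter_upwards [ih, coeFn_sineVec N, Lp.coeFn_smul (c N) (sineBasis N),
      Lp.coeFn_add (∑ j ∈ Finset.range N, c j • sineBasis j) (c N • sineBasis N)] with y h1 h2 h3 h4
    rw [h4, Pi.add_apply, h1, h3, Pi.smul_apply, hb, h2, Finset.sum_range_succ, smul_eq_mul]

end TrigonometricPolynomials

namespace IsSkeletonCoefficients

variable {T : ℝ} {v : L2TI T} {f g σ : ℝ → ℝ → ℝ → ℝ} {K L M : ℝ}

/-- For the sine polynomial `W` with coefficients `c`, the sum is `-∫ g W' + ∫ f W + ∫ σ v W - ∫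
W'²` with coefficients evaluated at `θ W`. Adding the null integral `∫ g(s,0,θW) W'` leaves only the
oscillation of `g` in `x`, of linear growth, and Young's inequality finishes. -/
theorem skeletonCoeff_energy (hc : IsSkeletonCoefficients T f g σ K L M) {s : ℝ}
    (hs : s ∈ Icc 0 T) (hv : MemLp (fun y => v (s, y)) 2 (volume.restrict (Icc (0 : ℝ) 1)))
    (N : ℕ) (c : ℕ → ℝ) {θ : ℝ} (hθ : θ ∈ Icc (0 : ℝ) 1) :
    ∑ n ∈ Finset.range N, c n * (skeletonCoeff f g σ v n s
        (θ • ∑ j ∈ Finset.range N, c j • sineBasis j) - sineFreq n ^ 2 * c n) ≤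
      (2 * K ^ 2 + 2 * K + 1 + M ^ 2) *
        (∑ n ∈ Finset.range N, c n ^ 2 + controlNorm v s ^ 2) := by
  have hK := hc.K_nonneg
  have hM := hc.M_nonneg
  have h0I : (0 : ℝ) ∈ Icc (0 : ℝ) 1 := ⟨le_rfl, zero_le_one⟩
  set w : L2I := θ • ∑ j ∈ Finset.range N, c j • sineBasis j
  set W : ℝ → ℝ := fun y => ∑ j ∈ Finset.range N, c j * sineFun j y with hW
  set W' : ℝ → ℝ := fun y => ∑ j ∈ Finset.range N, c j * sineFunDeriv j y with hW'
  have hWc : Continuous W :=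
    continuous_finsetSum _ fun j _ => continuous_const.mul (continuous_sineFun j)
  have hW'c : Continuous W' :=
    continuous_finsetSum _ fun j _ => continuous_const.mul (continuous_sineFunDeriv j)
  have hWd : ∀ y, HasDerivAt W (W' y) y := fun y =>
    HasDerivAt.fun_sum fun j _ => (hasDerivAt_sineFun j y).const_mul (c j)
  have hW0 : W 0 = W 1 := by simp [hW, sineFun_zero, sineFun_one]
  have hwW : ∀ᵐ y ∂(volume.restrict (Icc (0 : ℝ) 1)), w y = θ * W y := by
    filter_upwards [coeFn_sum_sineBasis N c,
      Lp.coeFn_smul θ (∑ j ∈ Finset.range N, c j • sineBasis j)] with y h1 h2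
    rw [h2, Pi.smul_apply, h1, smul_eq_mul]
  have hwm := measurable_coeFn_L2I w
  have hgi := hc.integrableOn_g hs hwm (Lp.memLp w)
  have hfi := hc.integrableOn_f hs hwm (Lp.memLp w)
  have hσi := hc.integrableOn_σ_mul hs hwm hv
  have hmul : ∀ {p e : ℝ → ℝ}, IntegrableOn p (Icc 0 1) → Continuous e →
      IntegrableOn (fun y => p y * e y) (Icc 0 1) := fun hp he =>
    hp.mul_continuousOn he.continuousOn isCompact_Icc
  have hsum : ∑ n ∈ Finset.range N, c n * (skeletonCoeff f g σ v n s w - sineFreq n ^ 2 * c n) =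
      -(∫ y in Icc (0 : ℝ) 1, g s y (w y) * W' y) + (∫ y in Icc (0 : ℝ) 1, f s y (w y) * W y) +
      (∫ y in Icc (0 : ℝ) 1, σ s y (w y) * v (s, y) * W y) - ∫ y in Icc (0 : ℝ) 1, W' y ^ 2 := by
    rw [hW', integral_sq_sum_of_orthogonal continuous_sineFunDeriv integral_sineFunDeriv_mul,
      ← sum_mul_integral_mul hgi continuous_sineFunDeriv,
      ← sum_mul_integral_mul hfi continuous_sineFun,
      ← sum_mul_integral_mul hσi continuous_sineFun, ← Finset.sum_neg_distrib,
      ← Finset.sum_add_distrib, ← Finset.sum_add_distrib, ← Finset.sum_sub_distrib]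
    refine Finset.sum_congr rfl fun n _ => ?_
    rw [skeletonCoeff]; ring
  have hq : Continuous fun r => g s 0 (θ * r) :=
    (continuous_of_locally_lipschitz_bound (hc.g_lip s hs 0 h0I)).comp (continuous_const_mul θ)
  have hzero := integral_comp_mul_deriv_eq_zero hq hWd hW'c hW0
  have hg0 : IntegrableOn (fun y => g s 0 (θ * W y) * W' y) (Icc 0 1) :=
    ((hq.comp hWc).mul hW'c).integrableOn_Icc
  have hWsq : ∫ y in Icc (0 : ℝ) 1, W y ^ 2 = ∑ n ∈ Finset.range N, c n ^ 2 := by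
    rw [hW, integral_sq_sum_of_orthogonal continuous_sineFun (κ := fun _ => 1) integral_sineFun_mul]
    simp
  have hW2i : IntegrableOn (fun y => W y ^ 2) (Icc 0 1) := (hWc.pow 2).integrableOn_Icc
  have hWd2 : IntegrableOn (fun y => W' y ^ 2) (Icc 0 1) := (hW'c.pow 2).integrableOn_Icc
  have hle : ∫ y in Icc (0 : ℝ) 1, (-(g s y (w y) * W' y) + g s 0 (θ * W y) * W' y +
      f s y (w y) * W y + σ s y (w y) * v (s, y) * W y - W' y ^ 2) ≤
      ∫ y in Icc (0 : ℝ) 1, ((2 * K ^ 2 + K) + (2 * K ^ 2 + 2 * K + 1) * W y ^ 2 +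
        M ^ 2 * v (s, y) ^ 2) := by
    refine integral_mono_ae (((((hmul hgi hW'c).neg.add hg0).add (hmul hfi hWc)).add
      (hmul hσi hWc)).sub hWd2) (((integrable_const _).add (hW2i.const_mul _)).add
      (hv.integrable_sq.const_mul _)) ?_
    filter_upwards [ae_restrict_mem measurableSet_Icc, hwW] with y hy hwy
    have h1 := hc.g_osc s hs y hy (w y)
    have h2 := hc.f_growth s hs y hy (w y)
    have h3 := hc.σ_bdd s hs y hy (w y)
    have hwle : |w y| ≤ |W y| := by
      rw [hwy, abs_mul, abs_of_nonneg hθ.1]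
      exact mul_le_of_le_one_left (abs_nonneg _) hθ.2
    rw [← hwy]
    -- Young's inequality is used with weight exactly 1 on `W'²`, so the dissipation cancels it
    -- completely.
    have e1 : -(g s y (w y) * W' y) + g s 0 (w y) * W' y ≤
        W' y ^ 2 + 2 * K ^ 2 * (1 + W y ^ 2) := by
      have : -(g s y (w y) * W' y) + g s 0 (w y) * W' y ≤ 2 * K * (1 + |W y|) * |W' y| := by
        calc -(g s y (w y) * W' y) + g s 0 (w y) * W' y
            = -((g s y (w y) - g s 0 (w y)) * W' y) := by ring
          _ ≤ |(g s y (w y) - g s 0 (w y)) * W' y| := neg_le_abs _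
          _ = |g s y (w y) - g s 0 (w y)| * |W' y| := abs_mul _ _
          _ ≤ 2 * K * (1 + |w y|) * |W' y| := by gcongr
          _ ≤ 2 * K * (1 + |W y|) * |W' y| := by gcongr
      have h4 : 2 * (K * (1 + |W y|)) * |W' y| ≤ (K * (1 + |W y|)) ^ 2 + |W' y| ^ 2 :=
        two_mul_le_add_sq _ _
      have h5 : (1 + |W y|) ^ 2 ≤ 2 * (1 + W y ^ 2) := by
        rw [← sq_abs (W y)]; nlinarith [sq_nonneg (1 - |W y|)]
      have h6 : K ^ 2 * (1 + |W y|) ^ 2 ≤ K ^ 2 * (2 * (1 + W y ^ 2)) := by gcongr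
      rw [mul_pow, sq_abs] at h4
      linarith
    have e2 : f s y (w y) * W y ≤ K * (1 + 2 * W y ^ 2) := by
      calc f s y (w y) * W y ≤ |f s y (w y)| * |W y| := by rw [← abs_mul]; exact le_abs_self _
        _ ≤ K * (1 + |W y|) * |W y| := by
          refine mul_le_mul_of_nonneg_right (h2.trans ?_) (abs_nonneg _)
          gcongr
        _ = K * (|W y| + |W y| ^ 2) := by ring
        _ ≤ K * (1 + 2 * W y ^ 2) := by
          rw [← sq_abs (W y)]
          refine mul_le_mul_of_nonneg_left ?_ hK
          nlinarith [sq_nonneg (|W y| - 1 / 2)]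
    have e3 : σ s y (w y) * v (s, y) * W y ≤ M ^ 2 * v (s, y) ^ 2 + W y ^ 2 := by
      calc σ s y (w y) * v (s, y) * W y ≤ |σ s y (w y) * v (s, y) * W y| := le_abs_self _
        _ = |σ s y (w y)| * (|v (s, y)| * |W y|) := by rw [abs_mul, abs_mul, mul_assoc]
        _ ≤ M * (|v (s, y)| * |W y|) := by gcongr
        _ ≤ M ^ 2 * v (s, y) ^ 2 + W y ^ 2 := by
          rw [← sq_abs (W y), ← sq_abs (v (s, y))]
          nlinarith [sq_nonneg (M * |v (s, y)| - |W y|), sq_nonneg (M * |v (s, y)|),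
            sq_nonneg |W y|]
    linarith
  rw [integral_sub
      (by exact (((hmul hgi hW'c).neg.add hg0).add (hmul hfi hWc)).add (hmul hσi hWc)) hWd2,
    integral_add (by exact ((hmul hgi hW'c).neg.add hg0).add (hmul hfi hWc)) (hmul hσi hWc),
    integral_add (by exact (hmul hgi hW'c).neg.add hg0) (hmul hfi hWc),
    integral_add (by exact (hmul hgi hW'c).neg) hg0, integral_neg, hzero, add_zero,
    integral_add (by exact (integrable_const _).add (hW2i.const_mul _))
      (hv.integrable_sq.const_mul _),
    integral_add (integrable_const _) (hW2i.const_mul _), integral_const_mul, integral_const_mul,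
    hWsq] at hle
  rw [hsum]
  refine hle.trans ?_
  have hV := one_add_integral_sq_le_controlNorm_sq v s
  have hv0 : 0 ≤ ∫ y in Icc (0 : ℝ) 1, v (s, y) ^ 2 := integral_nonneg fun y => sq_nonneg _
  have hc0 : 0 ≤ ∑ n ∈ Finset.range N, c n ^ 2 := Finset.sum_nonneg fun n _ => sq_nonneg _
  have hconst : ∫ _ in Icc (0 : ℝ) 1, (2 * K ^ 2 + K) = 2 * K ^ 2 + K := by simp
  rw [hconst]
  set I := ∫ y in Icc (0 : ℝ) 1, v (s, y) ^ 2
  set P := ∑ n ∈ Finset.range N, c n ^ 2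
  have h1 : (2 * K ^ 2 + 2 * K + 1 + M ^ 2) * (1 + I) ≤
      (2 * K ^ 2 + 2 * K + 1 + M ^ 2) * controlNorm v s ^ 2 := by gcongr
  have h2 : 0 ≤ (2 * K ^ 2 + 2 * K + 1) * I := by positivity
  have h3 : 0 ≤ M ^ 2 * P := by positivity
  have h4 : 0 ≤ M ^ 2 := by positivity
  linarith

theorem isMildNonlinearity (hc : IsSkeletonCoefficients T f g σ K L M) (v : L2TI T) :
    IsMildNonlinearity sineBasis sineFreq T (controlNorm v) (skeletonCoeff f g σ v)
      (Real.sqrt 2 * (3 * K + M + L)) (2 * K ^ 2 + 2 * K + 1 + M ^ 2) := by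
  have hK := hc.K_nonneg
  have hL := hc.L_nonneg
  have hM := hc.M_nonneg
  have hV : ∀ s, 0 ≤ controlNorm v s := fun s => zero_le_one.trans (one_le_controlNorm v s)
  have hae : ∀ᵐ s ∂(volume.restrict (Ioc (0 : ℝ) T)), s ∈ Icc 0 T ∧
      MemLp (fun y => v (s, y)) 2 (volume.restrict (Icc (0 : ℝ) 1)) := by
    filter_upwards [ae_memLp_section_L2TI v, ae_restrict_mem measurableSet_Ioc] with s hs hs'
    exact ⟨Ioc_subset_Icc_self hs', hs⟩
  refine ⟨sineFreq_pos, summable_inv_sineFreq_sq, memLp_controlNorm v, hV, by positivity,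
    by positivity, fun n u hu => hc.aestronglyMeasurable_skeletonCoeff n hu _, ?_, ?_, ?_⟩
  · filter_upwards [hae] with s hs n
    refine (hc.skeletonCoeff_zero_le hs.1 hs.2 n).trans ?_
    have := hV s
    have := sineFreq_pos n
    have h : 3 * K + M ≤ 3 * K + M + L := by linarith
    gcongr
  · filter_upwards [hae] with s hs n w z
    refine (hc.skeletonCoeff_lipschitz hs.1 hs.2 n w z).trans ?_
    have := hV s
    have := sineFreq_pos n
    gcongr
    linarith
  · filter_upwards [hae] with s hs N c θ hθ
    exact hc.skeletonCoeff_energy hs.1 hs.2 N c hθ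

end IsSkeletonCoefficients

/-! ### Sine series and heat kernel estimates. -/

section SineSeries

/-- The sum of a sine series. -/
def sineSeries (b : ℕ → ℝ) (x : ℝ) : ℝ := ∑' n, b n * sineFun n x

variable {b : ℕ → ℝ}

theorem norm_mul_sineFun_le (b : ℕ → ℝ) (n : ℕ) (x : ℝ) :
    ‖b n * sineFun n x‖ ≤ |b n| * Real.sqrt 2 := by
  rw [norm_mul, Real.norm_eq_abs, Real.norm_eq_abs]
  exact mul_le_mul_of_nonneg_left (abs_sineFun_le n x) (abs_nonneg _)

theorem continuous_sineSeries (hb : Summable fun n => |b n|) : Continuous (sineSeries b) :=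
  continuous_tsum (fun n => continuous_const.mul (continuous_sineFun n)) (hb.mul_right _)
    fun n x => norm_mul_sineFun_le b n x

theorem integral_sineSeries_mul (hb : Summable fun n => |b n|) {q : ℝ → ℝ}
    (hq : IntegrableOn q (Icc 0 1)) :
    ∫ x in Icc (0 : ℝ) 1, sineSeries b x * q x =
      ∑' n, b n * ∫ x in Icc (0 : ℝ) 1, q x * sineFun n x := by
  have h := hasSum_integral_of_dominated_convergence (μ := volume.restrict (Icc (0 : ℝ) 1))
    (F := fun n x => b n * sineFun n x * q x) (f := fun x => sineSeries b x * q x)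
    (fun n x => |b n| * Real.sqrt 2 * |q x|)
    (fun n => ((continuous_const.mul (continuous_sineFun n)).aestronglyMeasurable.mul
      hq.aestronglyMeasurable))
    (fun n => ae_of_all _ fun x => by
      rw [norm_mul]
      exact mul_le_mul_of_nonneg_right (norm_mul_sineFun_le b n x) (abs_nonneg _))
    (ae_of_all _ fun x => (hb.mul_right _).mul_right _)
    (by simp_rw [tsum_mul_right]; exact hq.abs.const_mul _)
    (ae_of_all _ fun x => (Summable.of_norm_bounded (hb.mul_right _)
      fun n => norm_mul_sineFun_le b n x).hasSum.mul_right _)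
  rw [← h.tsum_eq]
  refine tsum_congr fun n => ?_
  rw [← integral_const_mul]
  refine integral_congr_ae (ae_of_all _ fun x => ?_)
  ring

theorem integral_sineSeries_mul_sineFun (hb : Summable fun n => |b n|) (m : ℕ) :
    ∫ x in Icc (0 : ℝ) 1, sineSeries b x * sineFun m x = b m := by
  rw [integral_sineSeries_mul hb (continuous_sineFun m).integrableOn_Icc]
  simp_rw [integral_sineFun_mul, mul_ite, mul_one, mul_zero]
  rw [tsum_eq_single m fun n hn => by simp [hn.symm]]
  simp

theorem integral_sineSeries_sq (hb : Summable fun n => |b n|) :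
    ∫ x in Icc (0 : ℝ) 1, sineSeries b x ^ 2 = ∑' n, b n ^ 2 := by
  simp_rw [sq]
  rw [integral_sineSeries_mul hb (continuous_sineSeries hb).integrableOn_Icc]
  simp_rw [integral_sineSeries_mul_sineFun hb]

theorem integral_abs_sineSeries_le (hb : Summable fun n => |b n|) :
    ∫ x in Icc (0 : ℝ) 1, |sineSeries b x| ≤ Real.sqrt (∑' n, b n ^ 2) := by
  have hL : MemLp (sineSeries b) 2 (volume.restrict (Icc (0 : ℝ) 1)) :=
    (memLp_two_iff_integrable_sq (continuous_sineSeries hb).aestronglyMeasurable).2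
      ((continuous_sineSeries hb).pow 2).integrableOn_Icc
  have h := integral_abs_mul_abs_le (memLp_const (1 : ℝ)) hL
  rw [integral_sineSeries_sq hb] at h
  simpa using h

end SineSeries

section HeatKernel

theorem rpow_le_exp_two_mul {x q : ℝ} (hx : 0 ≤ x) (hq0 : 0 ≤ q) (hq : q ≤ 2) :
    x ^ q ≤ Real.exp (2 * x) := by
  have h1 : x ^ q ≤ 1 + x ^ 2 := by
    rcases le_total x 1 with h | h
    · exact (Real.rpow_le_one hx h hq0).trans (by nlinarith [sq_nonneg x])
    · have := Real.rpow_le_rpow_of_exponent_le h hq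
      rw [Real.rpow_two] at this
      linarith
  have h2 : 1 + x ≤ Real.exp x := by linarith [Real.add_one_le_exp x]
  calc x ^ q ≤ 1 + x ^ 2 := h1
    _ ≤ (1 + x) ^ 2 := by nlinarith
    _ ≤ Real.exp x ^ 2 := by gcongr
    _ = Real.exp (2 * x) := by rw [← Real.exp_nat_mul]; norm_num

theorem summable_sineFreq_rpow : Summable fun n => sineFreq n ^ (-(3 / 2) : ℝ) := by
  have h : Summable fun n : ℕ => ((n + 1 : ℕ) : ℝ) ^ (-(3 / 2) : ℝ) :=
    (summable_nat_add_iff 1).2 (Real.summable_nat_rpow.2 (by norm_num))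
  refine (h.mul_right (Real.pi ^ (-(3 / 2) : ℝ))).congr fun n => ?_
  rw [sineFreq, Real.mul_rpow (by positivity) Real.pi_pos.le]
  push_cast
  rfl

/-- The smoothing estimate for one Fourier mode. -/
theorem sineFreq_pow_mul_exp_sq_le {τ : ℝ} (hτ : 0 < τ) (j : ℕ) (hj : j ≤ 1) (n : ℕ) :
    (sineFreq n ^ j * Real.exp (-(sineFreq n ^ 2 * τ))) ^ 2 ≤
      τ ^ (-(3 / 4 + j : ℝ)) * sineFreq n ^ (-(3 / 2) : ℝ) := by
  have hk := sineFreq_pos n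
  set k := sineFreq n
  have hj' : (j : ℝ) ≤ 1 := by exact_mod_cast hj
  -- An exponent `q + j` leaves `k^(-2q)`, summable for `q > 1/2`, and after a square root a
  -- singularity `τ^(-(q+j)/2)`, integrable for `j = 1` when `q < 1`. The value `q = 3/4` lies in
  -- between.
  have h := rpow_le_exp_two_mul (x := k ^ 2 * τ) (q := 3 / 4 + j) (by positivity) (by positivity)
    (by linarith)
  have hpos : 0 < (k ^ 2 * τ) ^ (3 / 4 + j : ℝ) := by positivity
  have h1 : Real.exp (-(k ^ 2 * τ)) ^ 2 ≤ (k ^ 2 * τ) ^ (-(3 / 4 + j : ℝ)) := by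
    rw [← Real.exp_nat_mul, Real.rpow_neg (by positivity)]
    have : Real.exp (((2 : ℕ) : ℝ) * -(k ^ 2 * τ)) = (Real.exp (2 * (k ^ 2 * τ)))⁻¹ := by
      rw [← Real.exp_neg]; push_cast; ring_nf
    rw [this]
    exact inv_anti₀ hpos h
  rw [mul_pow]
  refine (mul_le_mul_of_nonneg_left h1 (by positivity)).trans (le_of_eq ?_)
  rw [Real.mul_rpow (by positivity) hτ.le, ← Real.rpow_natCast k 2, ← Real.rpow_mul hk.le,
    ← pow_mul, ← Real.rpow_natCast k (j * 2), ← mul_assoc, ← Real.rpow_add hk, mul_comm]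
  congr 2
  push_cast
  ring

theorem summable_sineFreq_mul_exp {τ : ℝ} (hτ : 0 < τ) :
    Summable fun n => sineFreq n * Real.exp (-(sineFreq n ^ 2 * τ)) := by
  refine Summable.of_nonneg_of_le (fun n => ?_) (fun n => ?_)
    (summable_inv_sineFreq_sq.mul_left (2 * (τ ^ 2)⁻¹))
  · exact mul_nonneg (sineFreq_pos n).le (Real.exp_pos _).le
  · have hk := one_le_sineFreq n
    have hk0 := sineFreq_pos n
    set k := sineFreq n
    have h1 := Real.quadratic_le_exp_of_nonneg (x := k ^ 2 * τ) (by positivity)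
    have h2 : (k ^ 2 * τ) ^ 2 / 2 ≤ Real.exp (k ^ 2 * τ) := by
      nlinarith [mul_pos (pow_pos hk0 2) hτ]
    rw [Real.exp_neg]
    calc k * (Real.exp (k ^ 2 * τ))⁻¹ ≤ k ^ 2 * ((k ^ 2 * τ) ^ 2 / 2)⁻¹ := by
          gcongr
          nlinarith
      _ = _ := by field_simp

/-- The kernel `∑ exp(-k_n² τ) β_n(y) e_n(x)`, set to zero for `τ ≤ 0`. -/
def heatKernel (β : ℕ → ℝ → ℝ) (τ x y : ℝ) : ℝ :=
  sineSeries (fun n => if 0 < τ then Real.exp (-(sineFreq n ^ 2 * τ)) * β n y else 0) x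

theorem heatKernel_of_pos (β : ℕ → ℝ → ℝ) {τ : ℝ} (hτ : 0 < τ) (x y : ℝ) :
    heatKernel β τ x y = sineSeries (fun n => Real.exp (-(sineFreq n ^ 2 * τ)) * β n y) x := by
  simp only [heatKernel, if_pos hτ]

theorem greenKernel_eq_sineSeries (τ x y : ℝ) : greenKernel τ x y =
    sineSeries (fun n => Real.exp (-(sineFreq n ^ 2 * τ)) * sineFun n y) x := by
  have h2 : Real.sqrt 2 * Real.sqrt 2 = 2 := Real.mul_self_sqrt (by norm_num)
  refine tsum_congr fun n => ?_
  simp only [sineFun, sineFreq, mul_pow]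
  linear_combination -(Real.exp (-(((n : ℝ) + 1) ^ 2 * Real.pi ^ 2 * τ)) *
    Real.sin (((n : ℝ) + 1) * Real.pi * x) * Real.sin (((n : ℝ) + 1) * Real.pi * y)) * h2

theorem greenKernel_comm (τ x y : ℝ) : greenKernel τ x y = greenKernel τ y x :=
  tsum_congr fun n => by ring

theorem greenKernelDy_eq_sineSeries {τ : ℝ} (hτ : 0 < τ) (x y : ℝ) : greenKernelDy τ x y =
    sineSeries (fun n => Real.exp (-(sineFreq n ^ 2 * τ)) * sineFunDeriv n y) x := by
  have h2 := Real.mul_self_sqrt (show (0 : ℝ) ≤ 2 by norm_num)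
  have hd : HasDerivAt (fun z => ∑' n, Real.exp (-(sineFreq n ^ 2 * τ)) * sineFun n z *
      sineFun n x) (∑' n, Real.exp (-(sineFreq n ^ 2 * τ)) * sineFunDeriv n y * sineFun n x) y := by
    refine hasDerivAt_tsum (u := fun n => 2 * (sineFreq n * Real.exp (-(sineFreq n ^ 2 * τ))))
      ((summable_sineFreq_mul_exp hτ).mul_left 2)
      (fun n z => ((hasDerivAt_sineFun n z).const_mul _).mul_const _) (fun n z => ?_) (y₀ := 0)
      ?_ y
    · rw [norm_mul, norm_mul, Real.norm_eq_abs, Real.norm_eq_abs, Real.norm_eq_abs, Real.abs_exp]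
      calc _ ≤ Real.exp (-(sineFreq n ^ 2 * τ)) * (Real.sqrt 2 * sineFreq n) * Real.sqrt 2 := by
            have := abs_sineFunDeriv_le n z
            have := abs_sineFun_le n x
            have := sineFreq_pos n
            gcongr
        _ = Real.sqrt 2 * Real.sqrt 2 * (sineFreq n * Real.exp (-(sineFreq n ^ 2 * τ))) := by ring
        _ = _ := by rw [h2]
    · simp [sineFun_zero]
  rw [greenKernelDy, show (fun z => greenKernel τ x z) = fun z => ∑' n,
    Real.exp (-(sineFreq n ^ 2 * τ)) * sineFun n z * sineFun n x from
      funext fun z => greenKernel_eq_sineSeries τ x z, hd.deriv]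
  rfl

/-- The regularity of the coefficient functions of the kernels `G` (`j = 0`) and `∂_y G`
(`j = 1`). -/
structure IsKernelFamily (β : ℕ → ℝ → ℝ) (j : ℕ) : Prop where
  le_one : j ≤ 1
  continuous : ∀ n, Continuous (β n)
  bound : ∀ n y, |β n y| ≤ Real.sqrt 2 * sineFreq n ^ j

theorem isKernelFamily_sineFun : IsKernelFamily sineFun 0 :=
  ⟨zero_le_one, continuous_sineFun, fun n y => by simpa using abs_sineFun_le n y⟩

theorem isKernelFamily_sineFunDeriv : IsKernelFamily sineFunDeriv 1 :=
  ⟨le_rfl, continuous_sineFunDeriv, fun n y => by simpa using abs_sineFunDeriv_le n y⟩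

namespace IsKernelFamily

variable {β : ℕ → ℝ → ℝ} {j : ℕ}

theorem summable (hβ : IsKernelFamily β j) {τ : ℝ} (hτ : 0 < τ) (y : ℝ) :
    Summable fun n => |Real.exp (-(sineFreq n ^ 2 * τ)) * β n y| := by
  refine Summable.of_nonneg_of_le (fun n => abs_nonneg _) (fun n => ?_)
    ((summable_sineFreq_mul_exp hτ).mul_left (Real.sqrt 2))
  have hk := one_le_sineFreq n
  rw [abs_mul, Real.abs_exp]
  have h1 : sineFreq n ^ j ≤ sineFreq n := by
    simpa using pow_le_pow_right₀ hk hβ.le_one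
  calc _ ≤ Real.exp (-(sineFreq n ^ 2 * τ)) * (Real.sqrt 2 * sineFreq n) := by
        have := hβ.bound n y
        gcongr
        exact this.trans (by gcongr)
    _ = _ := by ring

theorem summable_ite (hβ : IsKernelFamily β j) (τ y : ℝ) :
    Summable fun n => |if 0 < τ then Real.exp (-(sineFreq n ^ 2 * τ)) * β n y else 0| := by
  by_cases hτ : 0 < τ
  · simpa only [if_pos hτ] using hβ.summable hτ y
  · simpa only [if_neg hτ, abs_zero] using summable_zero

/-- The `L¹` norm in `x` is bounded by the `L²` norm, which Parseval computes as a sum over modes;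
the square root halves the exponent `3/4 + j`. The constant is uniform in `y`. -/
theorem exists_integral_abs_le (hβ : IsKernelFamily β j) : ∃ Z : ℝ, 0 ≤ Z ∧ ∀ τ y, 0 < τ →
    ∫ x in Icc (0 : ℝ) 1, |heatKernel β τ x y| ≤ Z * τ ^ (-(3 / 8 + j / 2 : ℝ)) := by
  refine ⟨Real.sqrt (2 * ∑' n, sineFreq n ^ (-(3 / 2) : ℝ)), Real.sqrt_nonneg _, fun τ y hτ => ?_⟩
  simp_rw [heatKernel_of_pos β hτ]
  refine (integral_abs_sineSeries_le (hβ.summable hτ y)).trans ?_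
  have h1 : τ ^ (-(3 / 8 + j / 2 : ℝ)) = Real.sqrt (τ ^ (-(3 / 4 + j : ℝ))) := by
    rw [Real.sqrt_eq_rpow, ← Real.rpow_mul hτ.le]
    congr 1
    ring
  have hterm : ∀ n, (Real.exp (-(sineFreq n ^ 2 * τ)) * β n y) ^ 2 ≤
      2 * τ ^ (-(3 / 4 + j : ℝ)) * sineFreq n ^ (-(3 / 2) : ℝ) := fun n => by
    have hk := sineFreq_pos n
    have h2 := sineFreq_pow_mul_exp_sq_le hτ j hβ.le_one n
    have h3 : (Real.exp (-(sineFreq n ^ 2 * τ)) * β n y) ^ 2 ≤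
        (Real.exp (-(sineFreq n ^ 2 * τ)) * (Real.sqrt 2 * sineFreq n ^ j)) ^ 2 := by
      rw [← sq_abs, abs_mul, Real.abs_exp]
      have := hβ.bound n y
      gcongr
    refine h3.trans ?_
    have h4 : (Real.exp (-(sineFreq n ^ 2 * τ)) * (Real.sqrt 2 * sineFreq n ^ j)) ^ 2 =
        Real.sqrt 2 ^ 2 * (sineFreq n ^ j * Real.exp (-(sineFreq n ^ 2 * τ))) ^ 2 := by ring
    rw [h4, Real.sq_sqrt (by norm_num), mul_assoc]
    linarith
  have hsum := summable_sineFreq_rpow.mul_left (2 * τ ^ (-(3 / 4 + j : ℝ)))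
  rw [h1, ← Real.sqrt_mul' _ (by positivity)]
  refine Real.sqrt_le_sqrt ?_
  calc _ ≤ ∑' n, 2 * τ ^ (-(3 / 4 + j : ℝ)) * sineFreq n ^ (-(3 / 2) : ℝ) :=
        (Summable.of_nonneg_of_le (fun n => sq_nonneg _) hterm hsum).tsum_le_tsum hterm hsum
    _ = _ := by rw [tsum_mul_left]; ring

/-- Because the kernel is cut to zero at nonpositive times, the partial sums converge at every
point. -/
theorem measurable_heatKernel (hβ : IsKernelFamily β j) (t : ℝ) :
    Measurable fun p : (ℝ × ℝ) × ℝ => heatKernel β (t - p.1.1) p.2 p.1.2 := by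
  refine measurable_of_tendsto_metrizable (f := fun N (p : (ℝ × ℝ) × ℝ) =>
    ∑ n ∈ Finset.range N, (if 0 < t - p.1.1 then
      Real.exp (-(sineFreq n ^ 2 * (t - p.1.1))) * β n p.1.2 else 0) * sineFun n p.2)
    (fun N => ?_) ?_
  · refine Finset.measurable_fun_sum _ fun n _ => Measurable.mul (Measurable.ite
      (measurableSet_lt measurable_const (by fun_prop)) (Measurable.mul (by fun_prop) ?_)
      measurable_const) ?_
    · exact (hβ.continuous n).measurable.comp (by fun_prop)
    · exact (continuous_sineFun n).measurable.comp measurable_snd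
  · rw [tendsto_pi_nhds]
    intro p
    exact (Summable.of_norm_bounded ((hβ.summable_ite (t - p.1.1) p.1.2).mul_right _)
      fun n => norm_mul_sineFun_le (fun n => if 0 < t - p.1.1 then
        Real.exp (-(sineFreq n ^ 2 * (t - p.1.1))) * β n p.1.2 else 0) n
          p.2).hasSum.tendsto_sum_nat

end IsKernelFamily

end HeatKernel

/-! ### Space-time convolution with the kernels. -/

section SpaceTimeConvolution

/-- Lebesgue measure on `(0,t) × [0,1]`. -/
abbrev spaceTimeMeasure (t : ℝ) : Measure (ℝ × ℝ) :=
  (volume.restrict (Ioo (0 : ℝ) t)).prod (volume.restrict (Icc (0 : ℝ) 1))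

/-- Iterated integrals depend only on the class of each section, so Fubini for `Φ` transfers to `F`
even without joint measurability of `F`. -/
theorem iterIntegrable_of_ae_eq {F : ℝ → ℝ → ℝ} {Φ : ℝ × ℝ → ℝ} {t : ℝ}
    (hΦ : Integrable Φ (spaceTimeMeasure t))
    (h : ∀ s ∈ Ioo 0 t, ∀ᵐ y ∂(volume.restrict (Icc (0 : ℝ) 1)), F s y = Φ (s, y)) :
    IterIntegrable F t ∧ iterInt F t = ∫ z, Φ z ∂(spaceTimeMeasure t) := by
  have h1 : ∀ᵐ s ∂(volume.restrict (Ioo (0 : ℝ) t)),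
      ∫ y in Icc (0 : ℝ) 1, Φ (s, y) = ∫ y in Icc (0 : ℝ) 1, F s y := by
    filter_upwards [ae_restrict_mem measurableSet_Ioo] with s hs
    exact integral_congr_ae ((h s hs).mono fun y hy => hy.symm)
  have h2 : ∀ᵐ s ∂(volume.restrict (Ioo (0 : ℝ) t)),
      ∫ y in Icc (0 : ℝ) 1, |Φ (s, y)| = ∫ y in Icc (0 : ℝ) 1, |F s y| := by
    filter_upwards [ae_restrict_mem measurableSet_Ioo] with s hs
    exact integral_congr_ae ((h s hs).mono fun y hy => by simp only; rw [hy])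
  refine ⟨⟨?_, hΦ.integral_prod_left.congr h1, hΦ.abs.integral_prod_left.congr h2⟩, ?_⟩
  · filter_upwards [hΦ.prod_right_ae, ae_restrict_mem measurableSet_Ioo] with s hs hs'
    exact hs.congr ((h s hs').mono fun y hy => hy.symm)
  · rw [integral_prod _ hΦ, iterInt]
    exact (integral_congr_ae h1).symm

theorem integrableOn_sub_rpow {t r : ℝ} (hr : -1 < r) :
    IntegrableOn (fun s => (t - s) ^ r) (Ioo 0 t) := by
  rcases le_or_gt t 0 with ht | ht
  · simp [Ioo_eq_empty (not_lt.2 ht)]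
  · have h := (intervalIntegral.intervalIntegrable_rpow' (a := t) (b := 0) hr).comp_sub_left t
    simp only [sub_self, sub_zero] at h
    rw [intervalIntegrable_iff_integrableOn_Ioo_of_le ht.le] at h
    exact h

theorem memLp_sub_rpow {t r : ℝ} (hr : -1 < 2 * r) :
    MemLp (fun s => (t - s) ^ r) 2 (volume.restrict (Ioo 0 t)) := by
  rw [memLp_two_iff_integrable_sq (by fun_prop : Measurable _).aestronglyMeasurable]
  refine (integrableOn_sub_rpow hr).congr ?_
  filter_upwards [ae_restrict_mem measurableSet_Ioo] with s hs
  rw [← Real.rpow_natCast, ← Real.rpow_mul (sub_pos.2 hs.2).le]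
  congr 1
  push_cast
  ring

theorem integrable_weight_mul_of_section_bound {φ : ℝ × ℝ → ℝ} (hφ : Measurable φ) {t r : ℝ}
    {m : ℝ → ℝ} (hm : IntegrableOn (fun s => (t - s) ^ r * m s) (Ioo 0 t))
    (hInt : ∀ᵐ s ∂(volume.restrict (Ioo (0 : ℝ) t)),
      IntegrableOn (fun y => φ (s, y)) (Icc 0 1) ∧ ∫ y in Icc (0 : ℝ) 1, |φ (s, y)| ≤ m s) :
    Integrable (fun z => (t - z.1) ^ r * |φ z|) (spaceTimeMeasure t) := by
  have hmeas : Measurable fun z : ℝ × ℝ => (t - z.1) ^ r * |φ z| :=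
    Measurable.mul (by fun_prop) hφ.abs
  rw [integrable_prod_iff hmeas.aestronglyMeasurable]
  refine ⟨?_, Integrable.mono' hm
    hmeas.norm.stronglyMeasurable.integral_prod_right'.aestronglyMeasurable ?_⟩
  · filter_upwards [hInt] with s hs
    exact hs.1.abs.const_mul _
  · filter_upwards [hInt, ae_restrict_mem measurableSet_Ioo] with s hs hs'
    have hpos : 0 ≤ (t - s) ^ r := Real.rpow_nonneg (sub_pos.2 hs'.2).le _
    rw [Real.norm_eq_abs, abs_of_nonneg (integral_nonneg fun y => norm_nonneg _)]
    simp_rw [norm_mul, Real.norm_eq_abs, abs_abs, abs_of_nonneg hpos]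
    rw [integral_const_mul]
    exact mul_le_mul_of_nonneg_left hs.2 hpos

namespace IsKernelFamily

variable {β : ℕ → ℝ → ℝ} {j : ℕ} {φ : ℝ × ℝ → ℝ} {t : ℝ}

/-- Integrating in `x` first uses the `L¹` kernel bound, uniform in `y`, and leaves only the time
weight against `|φ|`; thus `φ` need only be integrable in space. -/
theorem integrable_heatKernel_mul (hβ : IsKernelFamily β j) (hφ : Measurable φ)
    (hInt : Integrable (fun z => (t - z.1) ^ (-(3 / 8 + j / 2 : ℝ)) * |φ z|) (spaceTimeMeasure t)) :
    Integrable (fun p : (ℝ × ℝ) × ℝ => heatKernel β (t - p.1.1) p.2 p.1.2 * φ p.1)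
      ((spaceTimeMeasure t).prod (volume.restrict (Icc (0 : ℝ) 1))) := by
  obtain ⟨Z, hZ, hZle⟩ := hβ.exists_integral_abs_le
  have hmeas : Measurable fun p : (ℝ × ℝ) × ℝ => heatKernel β (t - p.1.1) p.2 p.1.2 * φ p.1 :=
    (hβ.measurable_heatKernel t).mul (hφ.comp measurable_fst)
  have htime : ∀ᵐ z ∂(spaceTimeMeasure t), z.1 ∈ Ioo 0 t :=
    Measure.quasiMeasurePreserving_fst.ae (ae_restrict_mem measurableSet_Ioo)
  rw [integrable_prod_iff hmeas.aestronglyMeasurable]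
  refine ⟨ae_of_all _ fun z => ?_, Integrable.mono' (hInt.const_mul Z)
    hmeas.norm.stronglyMeasurable.integral_prod_right'.aestronglyMeasurable ?_⟩
  · exact (continuous_sineSeries
      (hβ.summable_ite (t - z.1) z.2)).integrableOn_Icc.integrable.mul_const (φ z)
  · filter_upwards [htime] with z hz
    rw [Real.norm_eq_abs, abs_of_nonneg (integral_nonneg fun y => norm_nonneg _)]
    simp_rw [norm_mul, Real.norm_eq_abs]
    rw [integral_mul_const, ← mul_assoc]
    exact mul_le_mul_of_nonneg_right (hZle _ _ (sub_pos.2 hz.2)) (abs_nonneg _)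

/-- The space-time convolution with the kernel converges absolutely for almost every `x`, is
integrable, and has the expected sine coefficients. -/
theorem convolution (hβ : IsKernelFamily β j) (ht : 0 ≤ t) (hφ : Measurable φ)
    (hInt : Integrable (fun z => (t - z.1) ^ (-(3 / 8 + j / 2 : ℝ)) * |φ z|) (spaceTimeMeasure t)) :
    (∀ᵐ x ∂(volume.restrict (Icc (0 : ℝ) 1)),
      Integrable (fun z : ℝ × ℝ => heatKernel β (t - z.1) x z.2 * φ z) (spaceTimeMeasure t)) ∧
    IntegrableOn (fun x => ∫ z, heatKernel β (t - z.1) x z.2 * φ z ∂(spaceTimeMeasure t))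
      (Icc 0 1) ∧
    ∀ m, IntervalIntegrable (fun s => Real.exp (-(sineFreq m ^ 2 * (t - s))) *
        ∫ y in Icc (0 : ℝ) 1, φ (s, y) * β m y) volume 0 t ∧
      ∫ x in Icc (0 : ℝ) 1, (∫ z, heatKernel β (t - z.1) x z.2 * φ z ∂(spaceTimeMeasure t)) *
        sineFun m x =
      duhamel (sineFreq m ^ 2) (fun s => ∫ y in Icc (0 : ℝ) 1, φ (s, y) * β m y) t := by
  have hI := hβ.integrable_heatKernel_mul hφ hInt
  refine ⟨hI.prod_left_ae, hI.integral_prod_right, fun m => ?_⟩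
  have hIm : Integrable (fun p : (ℝ × ℝ) × ℝ =>
      heatKernel β (t - p.1.1) p.2 p.1.2 * φ p.1 * sineFun m p.2)
      ((spaceTimeMeasure t).prod (volume.restrict (Icc (0 : ℝ) 1))) :=
    hI.mul_bdd (c := Real.sqrt 2) ((continuous_sineFun m).comp continuous_snd).aestronglyMeasurable
      (ae_of_all _ fun p => abs_sineFun_le m p.2)
  have htime : ∀ᵐ z ∂(spaceTimeMeasure t), z.1 ∈ Ioo 0 t :=
    Measure.quasiMeasurePreserving_fst.ae (ae_restrict_mem measurableSet_Ioo)
  -- Testing against one sine in `x` extracts a single mode of the kernel; Fubini then yields the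
  -- Duhamel integral.
  have hinner : ∀ᵐ z ∂(spaceTimeMeasure t),
      ∫ x in Icc (0 : ℝ) 1, heatKernel β (t - z.1) x z.2 * φ z * sineFun m x =
        Real.exp (-(sineFreq m ^ 2 * (t - z.1))) * (φ z * β m z.2) := by
    filter_upwards [htime] with z hz
    have hτ := sub_pos.2 hz.2
    have e : ∀ x, heatKernel β (t - z.1) x z.2 * φ z * sineFun m x =
        φ z * (heatKernel β (t - z.1) x z.2 * sineFun m x) := fun x => by ring
    simp_rw [e, heatKernel_of_pos β hτ]
    rw [integral_const_mul, integral_sineSeries_mul_sineFun (hβ.summable hτ z.2)]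
    ring
  have hJ : Integrable (fun z : ℝ × ℝ => Real.exp (-(sineFreq m ^ 2 * (t - z.1))) *
      (φ z * β m z.2)) (spaceTimeMeasure t) := hIm.integral_prod_left.congr hinner
  have hs := hJ.integral_prod_left
  simp_rw [integral_const_mul] at hs
  constructor
  · rw [intervalIntegrable_iff_integrableOn_Ioo_of_le ht]
    exact hs
  · have hswap := integral_integral_swap (f := fun (z : ℝ × ℝ) (x : ℝ) =>
      heatKernel β (t - z.1) x z.2 * φ z * sineFun m x) hIm
    simp_rw [← integral_mul_const]
    rw [← hswap, integral_congr_ae hinner, integral_prod _ hJ, duhamel,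
      intervalIntegral.integral_of_le ht, integral_Ioc_eq_integral_Ioo]
    simp_rw [integral_const_mul]

end IsKernelFamily

theorem integral_greenKernel_mul {t : ℝ} (ht : 0 < t) (η : L2I) (x : ℝ) :
    ∫ y in Icc (0 : ℝ) 1, greenKernel t x y * η y =
      sineSeries (fun n => Real.exp (-(sineFreq n ^ 2 * t)) * inner ℝ (sineBasis n) η) x := by
  simp_rw [greenKernel_comm t x, greenKernel_eq_sineSeries t]
  rw [integral_sineSeries_mul (isKernelFamily_sineFun.summable ht x) (integrableOn_coeFn_L2I η)]
  refine tsum_congr fun n => ?_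
  simp only [inner_sineBasis]
  ring

theorem summable_exp_mul_inner_sineBasis {t : ℝ} (ht : 0 < t) (η : L2I) :
    Summable fun n => |Real.exp (-(sineFreq n ^ 2 * t)) * inner ℝ (sineBasis n) η| := by
  refine Summable.of_nonneg_of_le (fun n => abs_nonneg _) (fun n => ?_)
    ((summable_sineFreq_mul_exp ht).mul_right ‖η‖)
  have h1 : |inner ℝ (sineBasis n) η| ≤ ‖η‖ := by
    refine (abs_real_inner_le_norm _ _).trans ?_
    rw [sineBasis.orthonormal.1 n, one_mul]
  rw [abs_mul, Real.abs_exp]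
  refine mul_le_mul (le_mul_of_one_le_left (Real.exp_pos _).le (one_le_sineFreq n)) h1
    (abs_nonneg _) (mul_nonneg (sineFreq_pos n).le (Real.exp_pos _).le)

end SpaceTimeConvolution

/-! ### Equivalence of the skeleton equation with the mild equation. -/

namespace IsSkeletonCoefficients

variable {T : ℝ} {v : L2TI T} {f g σ : ℝ → ℝ → ℝ → ℝ} {K L M : ℝ}

theorem integral_abs_g_le (hc : IsSkeletonCoefficients T f g σ K L M) {s : ℝ} (hs : s ∈ Icc 0 T)
    (w : L2I) : ∫ y in Icc (0 : ℝ) 1, |g s y (w y)| ≤ 3 * K * (1 + ‖w‖ ^ 2) := by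
  have hi : IntegrableOn (fun y => 3 * K * (1 + w y ^ 2)) (Icc 0 1) :=
    ((integrable_const _).add (Lp.memLp w).integrable_sq).const_mul _
  have h := setIntegral_mono_on
    (hc.integrableOn_g hs (measurable_coeFn_L2I w) (Lp.memLp w)).abs hi measurableSet_Icc
    fun y hy => hc.g_growth s hs y hy (w y)
  refine h.trans (le_of_eq ?_)
  rw [integral_const_mul, integral_add (integrable_const _) (Lp.memLp w).integrable_sq,
    norm_sq_L2I]
  simp

theorem integral_abs_f_le (hc : IsSkeletonCoefficients T f g σ K L M) {s : ℝ} (hs : s ∈ Icc 0 T)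
    (w : L2I) : ∫ y in Icc (0 : ℝ) 1, |f s y (w y)| ≤ K * (1 + ‖w‖) := by
  have hi : IntegrableOn (fun y => K * (1 + |w y|)) (Icc 0 1) :=
    ((integrable_const _).add (integrableOn_coeFn_L2I w).abs).const_mul _
  have h := setIntegral_mono_on
    (hc.integrableOn_f hs (measurable_coeFn_L2I w) (Lp.memLp w)).abs hi measurableSet_Icc
    fun y hy => hc.f_growth s hs y hy (w y)
  refine h.trans ?_
  rw [integral_const_mul, integral_add (integrable_const _) (integrableOn_coeFn_L2I w).abs]
  refine mul_le_mul_of_nonneg_left (add_le_add ?_ (integral_abs_L2I_le w)) hc.K_nonneg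
  simp

theorem integral_abs_σ_mul_le (hc : IsSkeletonCoefficients T f g σ K L M) {s : ℝ}
    (hs : s ∈ Icc 0 T) (hv : MemLp (fun y => v (s, y)) 2 (volume.restrict (Icc (0 : ℝ) 1)))
    (w : L2I) : ∫ y in Icc (0 : ℝ) 1, |σ s y (w y) * v (s, y)| ≤ M * controlNorm v s := by
  have hi : IntegrableOn (fun y => M * |v (s, y)|) (Icc 0 1) :=
    (hv.integrable (by norm_num)).abs.const_mul _
  have h := setIntegral_mono_on
    (hc.integrableOn_σ_mul hs (measurable_coeFn_L2I w) hv).abs hi measurableSet_Icc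
    fun y hy => by
      rw [abs_mul]
      exact mul_le_mul_of_nonneg_right (hc.σ_bdd s hs y hy (w y)) (abs_nonneg _)
  refine h.trans ?_
  rw [integral_const_mul]
  refine mul_le_mul_of_nonneg_left ?_ hc.M_nonneg
  have h1 := integral_abs_mul_abs_le (memLp_const (1 : ℝ)) hv
  have h2 : ∫ y in Icc (0 : ℝ) 1, |v (s, y)| ≤
      Real.sqrt (∫ y in Icc (0 : ℝ) 1, v (s, y) ^ 2) := by simpa using h1
  rw [controlNorm]
  linarith

/-- The right-hand side of the skeleton equation converges absolutely and is the integrable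
function whose sine coefficients are the coordinates of the mild equation. -/
theorem exists_rightHandSide (hc : IsSkeletonCoefficients T f g σ K L M) (hT : 0 ≤ T) (η : L2I)
    (v : L2TI T) (h : C(Icc (0 : ℝ) T, L2I)) {t : ℝ} (ht : 0 < t) (htT : t ≤ T) :
    ∃ R : ℝ → ℝ, IntegrableOn R (Icc 0 1) ∧
      (∀ n, ∫ x in Icc (0 : ℝ) 1, R x * sineFun n x =
        mildCoord sineBasis sineFreq (skeletonCoeff f g σ v) η (IccExtend hT h) n t) ∧
      ∀ᵐ x ∂(volume.restrict (Icc (0 : ℝ) 1)),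
        IterIntegrable (fun s y => greenKernelDy (t - s) x y * g s y (IccExtend hT h s y)) t ∧
        IterIntegrable (fun s y => greenKernel (t - s) x y * f s y (IccExtend hT h s y)) t ∧
        IterIntegrable (fun s y => greenKernel (t - s) x y *
          (σ s y (IccExtend hT h s y) * v (s, y))) t ∧
        R x = (∫ y in Icc (0 : ℝ) 1, greenKernel t x y * η y)
          - iterInt (fun s y => greenKernelDy (t - s) x y * g s y (IccExtend hT h s y)) t
          + iterInt (fun s y => greenKernel (t - s) x y * f s y (IccExtend hT h s y)) t
          + iterInt (fun s y => greenKernel (t - s) x y *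
            (σ s y (IccExtend hT h s y) * v (s, y))) t := by
  have hK := hc.K_nonneg
  set u : ℝ → L2I := IccExtend hT h with hu_def
  have hu : Continuous u := h.continuous.Icc_extend'
  have huR : ∀ s, ‖u s‖ ≤ ‖h‖ := fun s => h.norm_coe_le_norm _
  obtain ⟨φ, hφ, hφu⟩ := exists_measurable_version hu
  have hcomp : Measurable fun p : ℝ × ℝ => ((p.1, p.2, φ p) : ℝ × ℝ × ℝ) :=
    measurable_fst.prodMk (measurable_snd.prodMk hφ)
  set φg : ℝ × ℝ → ℝ := fun z => g z.1 z.2 (φ z)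
  set φf : ℝ × ℝ → ℝ := fun z => f z.1 z.2 (φ z)
  set φσ : ℝ × ℝ → ℝ := fun z => σ z.1 z.2 (φ z) * v z
  have hφg : Measurable φg := hc.measurable_g.comp hcomp
  have hφf : Measurable φf := hc.measurable_f.comp hcomp
  have hφσ : Measurable φσ := (hc.measurable_σ.comp hcomp).mul (measurable_coeFn_L2TI v)
  have eg : ∀ s, ∀ᵐ y ∂(volume.restrict (Icc (0 : ℝ) 1)), g s y (u s y) = φg (s, y) := fun s =>
    (hφu s).mono fun y hy => by rw [hy]
  have ef : ∀ s, ∀ᵐ y ∂(volume.restrict (Icc (0 : ℝ) 1)), f s y (u s y) = φf (s, y) := fun s =>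
    (hφu s).mono fun y hy => by rw [hy]
  have eσ : ∀ s, ∀ᵐ y ∂(volume.restrict (Icc (0 : ℝ) 1)),
      σ s y (u s y) * v (s, y) = φσ (s, y) := fun s => (hφu s).mono fun y hy => by rw [hy]
  have hsub : Ioo 0 t ⊆ Ioc 0 T := fun s hs => ⟨hs.1, hs.2.le.trans htT⟩
  have hae : ∀ᵐ s ∂(volume.restrict (Ioo (0 : ℝ) t)), s ∈ Icc 0 T ∧
      MemLp (fun y => v (s, y)) 2 (volume.restrict (Icc (0 : ℝ) 1)) := by
    filter_upwards [ae_mono (Measure.restrict_mono_set _ hsub) (ae_memLp_section_L2TI v),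
      ae_restrict_mem measurableSet_Ioo] with s hs hs'
    exact ⟨Ioc_subset_Icc_self (hsub hs'), hs⟩
  have habs : ∀ {p q : ℝ → ℝ}, (∀ᵐ y ∂(volume.restrict (Icc (0 : ℝ) 1)), p y = q y) →
      ∫ y in Icc (0 : ℝ) 1, |q y| = ∫ y in Icc (0 : ℝ) 1, |p y| := fun hpq =>
    integral_congr_ae (hpq.mono fun y hy => by simp only [hy])
  have hg := isKernelFamily_sineFunDeriv.convolution ht.le hφg
    (integrable_weight_mul_of_section_bound hφg (m := fun _ => 3 * K * (1 + ‖h‖ ^ 2))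
      -- For `∂_y G` the time singularity has exponent `-(3/8 + 1/2) = -7/8 > -1`, and the spatial
      -- `L¹` norm of `g` is bounded in time.
      ((integrableOn_sub_rpow (by norm_num)).mul_const _) (by
        filter_upwards [hae] with s hs
        refine ⟨(hc.integrableOn_g hs.1 (measurable_coeFn_L2I _) (Lp.memLp (u s))).congr (eg s), ?_⟩
        rw [habs (eg s)]
        refine (hc.integral_abs_g_le hs.1 (u s)).trans ?_
        have := huR s
        gcongr))
  have hf := isKernelFamily_sineFun.convolution ht.le hφf
    (integrable_weight_mul_of_section_bound hφf (m := fun _ => K * (1 + ‖h‖))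
      ((integrableOn_sub_rpow (by norm_num)).mul_const _) (by
        filter_upwards [hae] with s hs
        refine ⟨(hc.integrableOn_f hs.1 (measurable_coeFn_L2I _) (Lp.memLp (u s))).congr (ef s), ?_⟩
        rw [habs (ef s)]
        refine (hc.integral_abs_f_le hs.1 (u s)).trans ?_
        have := huR s
        gcongr))
  have hV : MemLp (fun s => M * controlNorm v s) 2 (volume.restrict (Ioo 0 t)) :=
    ((memLp_controlNorm v).mono_measure (Measure.restrict_mono_set _ hsub)).const_mul M
  have hσ := isKernelFamily_sineFun.convolution ht.le hφσ
    (integrable_weight_mul_of_section_bound hφσ (m := fun s => M * controlNorm v s)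
      -- The control is only square integrable in time, so the weight must be too: `2 · (-3/8) =
      -- -3/4 > -1`.
      ((memLp_sub_rpow (by norm_num)).integrable_mul hV) (by
        filter_upwards [hae] with s hs
        refine ⟨(hc.integrableOn_σ_mul hs.1 (measurable_coeFn_L2I (u s)) hs.2).congr (eσ s), ?_⟩
        rw [habs (eσ s)]
        exact hc.integral_abs_σ_mul_le hs.1 hs.2 (u s)))
  obtain ⟨hg1, hg2, hg3⟩ := hg
  obtain ⟨hf1, hf2, hf3⟩ := hf
  obtain ⟨hσ1, hσ2, hσ3⟩ := hσ
  set P : ℝ → ℝ := sineSeries fun n => Real.exp (-(sineFreq n ^ 2 * t)) * inner ℝ (sineBasis n) η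
  have hPs := summable_exp_mul_inner_sineBasis ht η
  have hP : IntegrableOn P (Icc 0 1) := (continuous_sineSeries hPs).integrableOn_Icc
  set Jg : ℝ → ℝ := fun x =>
    ∫ z, heatKernel sineFunDeriv (t - z.1) x z.2 * φg z ∂(spaceTimeMeasure t)
  set Jf : ℝ → ℝ := fun x => ∫ z, heatKernel sineFun (t - z.1) x z.2 * φf z ∂(spaceTimeMeasure t)
  set Jσ : ℝ → ℝ := fun x => ∫ z, heatKernel sineFun (t - z.1) x z.2 * φσ z ∂(spaceTimeMeasure t)
  refine ⟨fun x => P x - Jg x + Jf x + Jσ x, ((hP.sub hg2).add hf2).add hσ2, fun n => ?_, ?_⟩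
  · have hmul : ∀ {p : ℝ → ℝ}, IntegrableOn p (Icc 0 1) →
        IntegrableOn (fun y => p y * sineFun n y) (Icc 0 1) := fun hp =>
      hp.mul_continuousOn (continuous_sineFun n).continuousOn isCompact_Icc
    simp_rw [add_mul, sub_mul]
    rw [integral_add (by exact ((hmul hP).sub (hmul hg2)).add (hmul hf2)) (hmul hσ2),
      integral_add (by exact (hmul hP).sub (hmul hg2)) (hmul hf2),
      integral_sub (hmul hP) (hmul hg2), (hg3 n).2, (hf3 n).2, (hσ3 n).2,
      integral_sineSeries_mul_sineFun hPs, mildCoord]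
    have e : (fun s => skeletonCoeff f g σ v n s (u s)) = fun s =>
        -(∫ y in Icc (0 : ℝ) 1, φg (s, y) * sineFunDeriv n y) +
          (∫ y in Icc (0 : ℝ) 1, φf (s, y) * sineFun n y) +
          ∫ y in Icc (0 : ℝ) 1, φσ (s, y) * sineFun n y := by
      funext s
      rw [skeletonCoeff, integral_congr_ae ((eg s).mono fun y hy => congrArg (· * _) hy),
        integral_congr_ae ((ef s).mono fun y hy => congrArg (· * _) hy),
        integral_congr_ae ((eσ s).mono fun y hy => congrArg (· * _) hy)]
    rw [e]
    simp only [duhamel]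
    simp_rw [mul_add, mul_neg]
    rw [intervalIntegral.integral_add (by exact (hg3 n).1.neg.add (hf3 n).1) (hσ3 n).1,
      intervalIntegral.integral_add (by exact (hg3 n).1.neg) (hf3 n).1,
      intervalIntegral.integral_neg]
    ring
  · filter_upwards [hg1, hf1, hσ1] with x hxg hxf hxσ
    have ig := iterIntegrable_of_ae_eq
      (F := fun s y => greenKernelDy (t - s) x y * g s y (u s y)) hxg fun s hs => by
        filter_upwards [eg s] with y hy
        rw [hy, heatKernel_of_pos _ (sub_pos.2 hs.2), greenKernelDy_eq_sineSeries (sub_pos.2 hs.2)]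
    have jf := iterIntegrable_of_ae_eq
      (F := fun s y => greenKernel (t - s) x y * f s y (u s y)) hxf fun s hs => by
        filter_upwards [ef s] with y hy
        rw [hy, heatKernel_of_pos _ (sub_pos.2 hs.2), greenKernel_eq_sineSeries]
    have jσ := iterIntegrable_of_ae_eq
      (F := fun s y => greenKernel (t - s) x y * (σ s y (u s y) * v (s, y))) hxσ fun s hs => by
        filter_upwards [eσ s] with y hy
        rw [hy, heatKernel_of_pos _ (sub_pos.2 hs.2), greenKernel_eq_sineSeries]
    refine ⟨ig.1, jf.1, jσ.1, ?_⟩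
    rw [ig.2, jf.2, jσ.2, integral_greenKernel_mul ht]

/-- Both sides of the equation have the same sine coefficients exactly when they agree almost
everywhere. `exists_rightHandSide` supplies only integrability of the right-hand side, hence the
need for completeness of the sines in `L¹`. Time zero is separate: there the coordinates reduce to
those of `η`. -/
theorem isSkeletonSolution_iff (hc : IsSkeletonCoefficients T f g σ K L M) (hT : 0 ≤ T) (η : L2I)
    (v : L2TI T) (h : C(Icc (0 : ℝ) T, L2I)) :
    IsSkeletonSolution hT f g σ η v h ↔ ∀ t n, inner ℝ (sineBasis n) (h t) =
      mildCoord sineBasis sineFreq (skeletonCoeff f g σ v) η (IccExtend hT h) n t := by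
  have hzero : ∀ n, mildCoord sineBasis sineFreq (skeletonCoeff f g σ v) η (IccExtend hT h) n 0 =
      inner ℝ (sineBasis n) η := fun n => by simp [mildCoord, duhamel]
  constructor
  · rintro ⟨h0, hsol⟩ t n
    rcases t.2.1.eq_or_lt with ht | ht
    · obtain rfl : t = ⟨0, left_mem_Icc.2 hT⟩ := Subtype.ext ht.symm
      rw [h0, hzero]
    · obtain ⟨R, -, hR, hae⟩ := hc.exists_rightHandSide hT η v h ht t.2.2
      rw [← hR n, inner_sineBasis]
      refine integral_congr_ae ?_
      filter_upwards [hae, hsol t ht] with x hx hx'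
      rw [hx'.2.2.2, hx.2.2.2]
  · intro hm
    refine ⟨eq_of_inner_basis_eq sineBasis fun n => by rw [hm, hzero], fun t ht => ?_⟩
    obtain ⟨R, hRi, hR, hae⟩ := hc.exists_rightHandSide hT η v h ht t.2.2
    have hi := integrableOn_coeFn_L2I (h t)
    have heq := ae_eq_zero_of_sine_coeff_eq_zero (hi.sub hRi) fun n => by
      have hmul : ∀ {p : ℝ → ℝ}, IntegrableOn p (Icc 0 1) →
          IntegrableOn (fun y => p y * sineFun n y) (Icc 0 1) := fun hp =>
        hp.mul_continuousOn (continuous_sineFun n).continuousOn isCompact_Icc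
      simp only [Pi.sub_apply, sub_mul]
      rw [integral_sub (hmul hi) (hmul hRi), hR, ← inner_sineBasis, hm, sub_self]
    filter_upwards [hae, heq] with x hx hx'
    refine ⟨hx.1, hx.2.1, hx.2.2.1, ?_⟩
    rw [sub_eq_zero.1 hx', hx.2.2.2]

end IsSkeletonCoefficients

end

theorem mainTheorem4 (T : ℝ) (hT : 0 < T)
    (f g σ g₁ : ℝ → ℝ → ℝ → ℝ) (g₂ : ℝ → ℝ → ℝ) (K L M : ℝ)
    (hf : Measurable fun p : ℝ × ℝ × ℝ => f p.1 p.2.1 p.2.2)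
    (hg₁ : Measurable fun p : ℝ × ℝ × ℝ => g₁ p.1 p.2.1 p.2.2)
    (hg₂ : Measurable fun p : ℝ × ℝ => g₂ p.1 p.2)
    (hg : Measurable fun p : ℝ × ℝ × ℝ => g p.1 p.2.1 p.2.2)
    (hσ : Measurable fun p : ℝ × ℝ × ℝ => σ p.1 p.2.1 p.2.2)
    (hf_growth : ∀ t ∈ Set.Icc 0 T, ∀ x ∈ Set.Icc (0 : ℝ) 1, ∀ r,
      |f t x r| ≤ K * (1 + |r|))
    (hg_decomp : ∀ t ∈ Set.Icc 0 T, ∀ x ∈ Set.Icc (0 : ℝ) 1, ∀ r,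
      g t x r = g₁ t x r + g₂ t r)
    (hg₁_growth : ∀ t ∈ Set.Icc 0 T, ∀ x ∈ Set.Icc (0 : ℝ) 1, ∀ r,
      |g₁ t x r| ≤ K * (1 + |r|))
    (hg₂_growth : ∀ t ∈ Set.Icc 0 T, ∀ r, |g₂ t r| ≤ K * (1 + |r| ^ 2))
    (hσ_bdd : ∀ t ∈ Set.Icc 0 T, ∀ x ∈ Set.Icc (0 : ℝ) 1, ∀ r, |σ t x r| ≤ M)
    (hσ_lip : ∀ t ∈ Set.Icc 0 T, ∀ x ∈ Set.Icc (0 : ℝ) 1, ∀ p q,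
      |σ t x p - σ t x q| ≤ L * |p - q|)
    (hf_lip : ∀ t ∈ Set.Icc 0 T, ∀ x ∈ Set.Icc (0 : ℝ) 1, ∀ p q,
      |f t x p - f t x q| ≤ L * (1 + |p| + |q|) * |p - q|)
    (hg_lip : ∀ t ∈ Set.Icc 0 T, ∀ x ∈ Set.Icc (0 : ℝ) 1, ∀ p q,
      |g t x p - g t x q| ≤ L * (1 + |p| + |q|) * |p - q|)
    (η : L2I) (v : L2TI T) :
    ∃! h : C(Set.Icc (0 : ℝ) T, L2I), IsSkeletonSolution hT.le f g σ η v h := by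
  have h0T : (0 : ℝ) ∈ Set.Icc 0 T := ⟨le_rfl, hT.le⟩
  have h0I : (0 : ℝ) ∈ Set.Icc (0 : ℝ) 1 := ⟨le_rfl, zero_le_one⟩
  have hK : 0 ≤ K := by simpa using (abs_nonneg _).trans (hf_growth 0 h0T 0 h0I 0)
  have hL : 0 ≤ L := by simpa using (abs_nonneg _).trans (hσ_lip 0 h0T 0 h0I 1 0)
  have hM : 0 ≤ M := (abs_nonneg _).trans (hσ_bdd 0 h0T 0 h0I 0)
  have hc : IsSkeletonCoefficients T f g σ K L M := by
    refine ⟨hK, hL, hM, hf, hg, hσ, hf_growth, fun t ht x hx r => ?_, fun t ht x hx r => ?_,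
      hσ_bdd, hσ_lip, hf_lip, hg_lip⟩
    · rw [hg_decomp t ht x hx]
      refine (abs_add_le _ _).trans ?_
      have h1 := hg₁_growth t ht x hx r
      have h2 := hg₂_growth t ht r
      rw [sq_abs] at h2
      -- Linear growth costs `2K` against `1 + r²`, the quadratic part another `K`: together the
      -- constant `3K`.
      have h3 : K * (1 + |r|) ≤ K * (2 * (1 + r ^ 2)) := by
        refine mul_le_mul_of_nonneg_left ?_ hK
        rw [← sq_abs r]
        nlinarith [sq_nonneg (|r| - 1)]
      linarith
    · rw [hg_decomp t ht x hx, hg_decomp t ht 0 h0I, add_sub_add_right_eq_sub]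
      refine (abs_sub _ _).trans ?_
      linarith [hg₁_growth t ht x hx r, hg₁_growth t ht 0 h0I r]
  simp_rw [hc.isSkeletonSolution_iff hT.le η v]
  exact (hc.isMildNonlinearity v).existsUnique_mild hT.le η
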